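/- **Setting.** An input of size $n\ge 1$ consists of servers $s_1\le\dots\le s_n$ and requests $r_1,\dots,r_n$, all real. The servers are known in advance, the requests arrive one by one, and each must be matched irrevocably, upon arrival, to an unmatched server at cost equal to their distance; $\mathrm{OPT}$ is the minimal total cost of a perfect matching. A (deterministic or randomized) online algorithm $A$ without advice is *$c(n)$-competitive* if there is a constant $a$ such that on every input of every size $n$ its (expected) cost is at most $c(n)\cdot\mathrm{OPT}+a$. An online algorithm with advice may in addition read bits, one after the other, from an infinite tape, which an oracle that knows the whole input (but not the random choices) has written. **Algorithm LR** (one bit of advice per request at most). A request $r$ is matched to an unmatched server at $r$ if there is one; otherwise, if all unmatched servers lie on one side of $r$, to the nearest one; otherwise a bit is read, and $r$ is matched to the nearest unmatched server to its left (bit $0$) or to its right (bit $1$). **Algorithm $\mathrm{DIVIDE}_k$** ($1\le k\le n$; subroutine $A$; servers in $[1,N-1]$ with $s_1=1$, where $N\in\mathbb Z^+$; integer requests). Split the servers, in order, into consecutive blocks $S_1,\dots,S_k$, the first $n \bmod k$ of size $\lceil n/k\rceil$ and the others of size $\lfloor n/k\rfloor$. Let $p_i$ be the midpoint of the last server of $S_i$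 and the first server of $S_{i+1}$, and $B_i=(p_{i-1},p_i]$ with $p_0=-\infty$, $p_k=\infty$. The position of a request is understood to be cut off at $0$ and at $N$. The advice refers to an optimal matching that is monotone in the positions. For $i=2,\dots,k$ a word $q_{i,L}$ is read: the position of the rightmost request in $B_i$ whose server is in some $S_j$, $j<i$ ($0$ if there is none). For $i=1,\dots,k-1$ a word $q_{i,R}$ is read: the position of the leftmost request in $B_i$ whose server is in some $S_j$, $j>i$ (the all-1 word if there is none). These words have as many bits as $N$ has binary digits. Then, for $i=1,\dots,k-1$, if $q_{i,R}$ is not the all-1 word, two numbers are read, each with as many bits as $n$ has binary digits: $d_{i,R}$, the number of requests at $q_{i,R}$ with server in $S_i$, and $m_{i,R}$, the number of requests in $B_i$ with server in some $S_j$, $j>i$; the first $m_{i,R}$ servers of $\bigcup_{j>i}S_j$ not yet marked in this round are marked. Then, for $i=k,\dots,2$, if $q_{i,L}\neq0$, two such numbers are read: $d_{i,L}$, the number of requests at $q_{i,L}$ with server in $\bigcup_{j\ge i}S_j$, and $m_{i,L}$, the number of requests in $B_i$ with server in some $S_j$, $j<i$; the last $m_{i,L}$ servers of $\bigcup_{j<i}S_j$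 not yet marked in this round are marked. After that, requests are served as follows. A request in $B_i$ at a position $>q_{i,R}$ is marked "right", one at a position $<q_{i,L}$ is marked "left"; if $q_{i,L}\ne q_{i,R}$, then of the requests at $q_{i,R}$ (at $q_{i,L}$) the first $d_{i,R}$ (the first $d_{i,L}$) are left unmarked and the later ones are marked "right" ("left"); if $q_{i,L}=q_{i,R}$, then of the requests at this point the first $d_{i,R}$ are left unmarked, the next ones, up to the $d_{i,L}$-th, are marked "right", and the later ones "left"; all other requests are left unmarked. Marked requests are served by LR on the marked servers, with advice bit $1$ for "right" and $0$ for "left" (these bits are produced by $\mathrm{DIVIDE}_k$ itself); unmarked requests in $B_i$ are served by $A$ on the unmarked servers of $S_i$. **Algorithm RESCALE** (for arbitrary real servers and requests). Put $s_i'=n^3(s_i-s_1)+1$, $r_i'=\lfloor n^3(r_i-s_1)\rfloor+1$ and $N=\lceil s_n'-s_1'\rceil+2$. Execute $\mathrm{DIVIDE}_k$ on this modified input, and match $r_i$ to $s_j$ when $\mathrm{DIVIDE}_k$ matches $r_i'$ to $s_j'$. **Theorem.** There is an absolute constant $C$ with the following property. Let $c:\mathbb N\to\mathbb R$ be nondecreasing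 with $c(n)=o(n^2)$, and let $A$ be a $c(n)$-competitive (deterministic or randomized) online algorithm. Then there is a constant $b$, depending only on $A$ and $c$, such that for all $1\le k\le n$ and every input of size $n$ there is an advice tape with which RESCALE, with subroutine $A$, produces a perfect matching of (expected) cost at most $$c(\lceil n/k\rceil)\cdot \mathrm{OPT}+b$$ and reads at most $$C\,k\,\bigl(\max\{0,\log(s_n-s_1)\}+\log n\bigr)$$ bits of advice (where $\log (s_n-s_1)$ is replaced by $0$ if $s_n=s_1$). That is, RESCALE is $c(n/k)$-competitive and reads $O(k(\log(s_n-s_1)+\log n))$ bits of advice. -/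

import Mathlib

open MeasureTheory

noncomputable section

/-! ### Inputs, matchings, optimal cost

An input is a list `s` of servers and a list `r` of requests of the same length.  A matching is a list
of (0-based) server indices: its `t`-th entry is the server of the `t`-th request. -/

structure IsInput (s r : List ℝ) : Prop where
  sorted : s.Pairwise (· ≤ ·)
  length_eq : r.length = s.length

/-- `m` is a permutation of the server indices. -/
def IsMatching (s : List ℝ) (m : List ℕ) : Prop :=
  m.Perm (List.range s.length)

/-- The total distance between the requests and their servers. -/
def matchingCost (s r : List ℝ) (m : List ℕ) : ℝ :=
  (List.zipWith (fun x j => |x - s.getD j 0|) r m).sum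

/-- The optimal offline cost (a minimum over finitely many matchings). -/
def optCost (s r : List ℝ) : ℝ :=
  sInf (matchingCost s r '' {m | IsMatching s m})

/-- `s_n - s_1`. -/
def serverSpan (s : List ℝ) : ℝ := s.getLastD 0 - s.headD 0

/-! ### Online algorithms without advice -/

/-- `A s past x` is the index of the server used for the request `x`, when the servers are `s` and
`past` is the list of the earlier requests, in order of arrival. -/
abbrev OnlineAlg := List ℝ → List ℝ → ℝ → ℕ

namespace OnlineAlg

def serve (A : OnlineAlg) (s : List ℝ) : List ℝ → List ℝ → List ℕ
  | _, [] => []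
  | past, x :: xs => A s past x :: serve A s (past ++ [x]) xs

/-- The list of the servers chosen by `A` for the request sequence `r`. -/
def output (A : OnlineAlg) (s r : List ℝ) : List ℕ := A.serve s [] r

end OnlineAlg

/-- A random matching: a matching for every outcome, and a measurable function of the outcome. -/
structure IsRandomMatching {Ω : Type*} [MeasurableSpace Ω] (s : List ℝ) (f : Ω → List ℕ) : Prop where
  isMatching : ∀ ω, IsMatching s (f ω)
  measurable : ∀ m, MeasurableSet {ω | f ω = m}

/-- The possibly randomized online algorithm `A` (a random choice of a deterministic one, with outcome
`ω` distributed according to `μ`) is `c(n)`-competitive: on inputs of size `n` its expected cost is at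
most `c(n)` times the optimum, plus a constant.  Deterministic algorithms are the case of a one-point
`Ω`. -/
def IsCompetitive {Ω : Type*} [MeasurableSpace Ω] (μ : Measure Ω) (A : Ω → OnlineAlg)
    (c : ℕ → ℝ) : Prop :=
  ∃ a : ℝ, ∀ s r : List ℝ, IsInput s r →
    IsRandomMatching s (fun ω => (A ω).output s r) ∧
    ∫ ω, matchingCost s r ((A ω).output s r) ∂μ ≤ c s.length * optCost s r + a

/-! ### Reading advice from a tape -/

/-- A computation that may read bits, one after the other, from an advice tape. -/
inductive AdviceProg (β : Type) : Type
  | ret (b : β) : AdviceProg β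
  | read (next : Bool → AdviceProg β) : AdviceProg β

namespace AdviceProg

def andThen {β γ : Type} : AdviceProg β → (β → AdviceProg γ) → AdviceProg γ
  | ret b, f => f b
  | read next, f => read fun bit => (next bit).andThen f

instance : Monad AdviceProg where
  pure := ret
  bind := andThen

/-- The result on the infinite tape `φ`, together with the number of bits read. -/
def run {β : Type} : AdviceProg β → (ℕ → Bool) → β × ℕ
  | ret b, _ => (b, 0)
  | read next, φ =>
    let res := (next (φ 0)).run (fun i => φ (i + 1))
    (res.1, res.2 + 1)

/-- Read a `w`-bit word, as a number in binary, most significant bit first. -/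
def readWord : ℕ → AdviceProg ℕ
  | 0 => pure 0
  | w + 1 => read fun bit => do
      let v ← readWord w
      pure (bit.toNat * 2 ^ w + v)

/-- Run `f i` for the indices `i` of a list, in this order, and collect the results in a function of
the index, with the value `b₀` at all other indices. -/
def forIndices {β : Type} (b₀ : β) (f : ℕ → AdviceProg β) : List ℕ → AdviceProg (ℕ → β)
  | [] => pure fun _ => b₀
  | i :: is => do
      let b ← f i
      let g ← forIndices b₀ f is
      pure (Function.update g i b)

end AdviceProg

/-- An online algorithm with advice in the tape model: it may read advice when it gets the servers,
and again upon the arrival of every request; then it answers with the index of a server. -/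
structure AdviceAlg where
  State : Type
  init : List ℝ → AdviceProg State
  step : State → ℝ → AdviceProg (ℕ × State)

namespace AdviceAlg

def serve (R : AdviceAlg) : R.State → List ℝ → AdviceProg (List ℕ)
  | _, [] => pure []
  | st, x :: xs => do
      let res ← R.step st x
      let js ← R.serve res.2 xs
      pure (res.1 :: js)

/-- The servers chosen for the request sequence `r` with the advice tape `φ`. -/
def output (R : AdviceAlg) (s r : List ℝ) (φ : ℕ → Bool) : List ℕ :=
  ((R.init s >>= fun st => R.serve st r).run φ).1

/-- The number of advice bits read on the request sequence `r` with the advice tape `φ`. -/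
def bitsRead (R : AdviceAlg) (s r : List ℝ) (φ : ℕ → Bool) : ℕ :=
  ((R.init s >>= fun st => R.serve st r).run φ).2

end AdviceAlg

/-! ### Algorithm LR -/

/-- The state of LR: the unmatched servers (index and position), in increasing order. -/
def lrInit (s : List ℝ) : List (ℕ × ℝ) := s.zipIdx.map Prod.swap

def lrChoose (st : List (ℕ × ℝ)) (x : ℝ) : AdviceProg ℕ :=
  match st.filter (fun p => p.2 = x) with
  | p :: _ => pure p.1
  | [] =>
    match (st.filter (fun p => p.2 < x)).getLast?, (st.filter (fun p => x < p.2)).head? with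
    | none, some p => pure p.1
    | some p, none => pure p.1
    | some p, some q => AdviceProg.read fun bit => pure (if bit then q.1 else p.1)
    | none, none => pure 0

def lrStep (st : List (ℕ × ℝ)) (x : ℝ) : AdviceProg (ℕ × List (ℕ × ℝ)) := do
  let j ← lrChoose st x
  pure (j, st.filter fun p => p.1 ≠ j)

/-- Algorithm LR. -/
def LR : AdviceAlg where
  State := List (ℕ × ℝ)
  init s := pure (lrInit s)
  step := lrStep

/-! ### Algorithm DIVIDE -/

/-- The number of servers in the first `i` of the `k` blocks of `n` servers: the first `n mod k` blocks
have `⌈n/k⌉` servers each, the other ones `⌊n/k⌋`.  So `S_i` (`1 ≤ i ≤ k`) consists of the servers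
with 0-based index `j`, `blockEnd n k (i-1) ≤ j < blockEnd n k i`. -/
def blockEnd (n k i : ℕ) : ℕ :=
  if i ≤ n % k then i * (n ⌈/⌉ k) else (n % k) * (n ⌈/⌉ k) + (i - n % k) * (n / k)

/-- What DIVIDE knows after reading the advice. `qL i = none` and `qR i = none` mean that no request of
the `i`-th block has to be served from the left, respectively from the right. -/
structure DivideSetup where
  servers : List ℝ
  k : ℕ
  N : ℕ
  qL : ℕ → Option ℕ
  qR : ℕ → Option ℕ
  dL : ℕ → ℕ
  mL : ℕ → ℕ
  dR : ℕ → ℕ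
  mR : ℕ → ℕ

inductive Mark
  | unmarked
  | right
  | left

namespace DivideSetup

variable (D : DivideSetup)

def n : ℕ := D.servers.length

/-- The division point `p_i` between the blocks `i` and `i + 1`, for `1 ≤ i ≤ k - 1`: the midpoint of
the last server of `S_i` and the first server of `S_{i+1}`. -/
def p (i : ℕ) : ℝ :=
  (D.servers.getD (blockEnd D.n D.k i - 1) 0 + D.servers.getD (blockEnd D.n D.k i) 0) / 2

/-- The number `j` of the block `B_j = (p_{j-1}, p_j]` of a point, where `p_0 = -∞`, `p_k = ∞`. -/
def block (x : ℝ) : ℕ := 1 + ((List.Ico 1 D.k).filter fun i => D.p i < x).length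

/-- The position of an integer point, cut off at `0` and at `N`. -/
def pos (x : ℝ) : ℕ := ⌊min x D.N⌋₊

/-- First marking procedure, for the blocks `1, …, k - 1`. -/
def markedR : List ℕ :=
  (List.Ico 1 D.k).foldl (fun M i => M ++
    ((List.range D.n).filter fun j => blockEnd D.n D.k i ≤ j ∧ j ∉ M).take (D.mR i)) []

/-- Second marking procedure, for the blocks `k, k - 1, …, 2`. -/
def markedL : List ℕ :=
  (List.Ico 2 (D.k + 1)).reverse.foldl (fun M i => M ++
    ((List.range D.n).reverse.filter fun j => j < blockEnd D.n D.k (i - 1) ∧ j ∉ M).take (D.mL i)) []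

/-- The indices of the marked servers, in increasing order. -/
def markedServers : List ℕ :=
  (List.range D.n).filter fun j => j ∈ D.markedR ∨ j ∈ D.markedL

/-- The indices of the unmarked servers of `S_i`, in increasing order. -/
def unmarkedServers (i : ℕ) : List ℕ :=
  (List.range D.n).filter fun j =>
    blockEnd D.n D.k (i - 1) ≤ j ∧ j < blockEnd D.n D.k i ∧ j ∉ D.markedR ∧ j ∉ D.markedL

/-- Positions of a list of servers given by indices. -/
def positions (l : List ℕ) : List ℝ := l.map fun j => D.servers.getD j 0

open Classical in
/-- The treatment of the request `x` after the requests in `past`.  In its block `i`, requests to the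
right of `q_{i,R}` are marked (to the right), requests to the left of `q_{i,L}` are marked (to the
left).  Of the requests at `q_{i,R}` the first `d_{i,R}` ones, and of the requests at `q_{i,L}` the
first `d_{i,L}` ones, are not served from the right, respectively from the left. If
`q_{i,L} = q_{i,R}`, this leaves first `d_{i,R}` unmarked requests, then, up to the `d_{i,L}`-th one,
requests marked to the right, and then requests marked to the left. -/
def mark (past : List ℝ) (x : ℝ) : Mark :=
  let i := D.block x
  let y := D.pos x
  let cnt := (past.filter fun z => D.pos z = y).length
  if (∃ q, D.qR i = some q ∧ q < y) then .right
  else if (∃ q, D.qL i = some q ∧ y < q) then .left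
  else if D.qR i = some y ∧ D.qL i = some y then
    if cnt < D.dR i then .unmarked else if cnt < D.dL i then .right else .left
  else if D.qR i = some y then
    if cnt < D.dR i then .unmarked else .right
  else if D.qL i = some y then
    if cnt < D.dL i then .unmarked else .left
  else .unmarked

end DivideSetup

/-- Reading the advice of DIVIDE, in four rounds: the words `q_{i,L}` for `i = 2, …, k` (`0` means that
there is no such request), the words `q_{i,R}` for `i = 1, …, k - 1` (the all-1 word means that there
is none), then `d_{i,R}` and `m_{i,R}` for `i = 1, …, k - 1`, and `d_{i,L}` and `m_{i,L}` for
`i = k, …, 2`, in the blocks where there is such a request. `Nat.size N` is the number of binary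
digits of `N`. -/
def divideRead (k N : ℕ) (s : List ℝ) : AdviceProg DivideSetup := do
  let w := Nat.size N
  let v := Nat.size s.length
  let qL ← AdviceProg.forIndices none (fun _ => do
    let q ← AdviceProg.readWord w
    pure (if q = 0 then none else some q)) (List.Ico 2 (k + 1))
  let qR ← AdviceProg.forIndices none (fun _ => do
    let q ← AdviceProg.readWord w
    pure (if q = 2 ^ w - 1 then none else some q)) (List.Ico 1 k)
  let readPair : Option ℕ → AdviceProg (ℕ × ℕ) := fun q =>
    match q with
    | none => pure (0, 0)
    | some _ => do
        let d ← AdviceProg.readWord v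
        let m ← AdviceProg.readWord v
        pure (d, m)
  let dmR ← AdviceProg.forIndices (0, 0) (fun i => readPair (qR i)) (List.Ico 1 k)
  let dmL ← AdviceProg.forIndices (0, 0) (fun i => readPair (qL i)) (List.Ico 2 (k + 1)).reverse
  pure
    { servers := s, k := k, N := N, qL := qL, qR := qR
      dL := fun i => (dmL i).1, mL := fun i => (dmL i).2
      dR := fun i => (dmR i).1, mR := fun i => (dmR i).2 }

/-- The state while serving requests: the requests so far, the unmarked requests of each block so far
(the input of `A` in this block), and the state of LR on the marked servers. -/
structure DivideState where
  setup : DivideSetup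
  past : List ℝ
  unmarked : ℕ → List ℝ
  lr : List (ℕ × ℝ)

def divideInit (k N : ℕ) (s : List ℝ) : AdviceProg DivideState := do
  let D ← divideRead k N s
  pure
    { setup := D, past := [], unmarked := fun _ => []
      lr := lrInit (D.positions D.markedServers) }

/-- Serve a marked request by LR, run on the marked servers and requests; `bit` is what LR finds on
its auxiliary tape if it reads a bit. -/
def divideMarkedStep (st : DivideState) (x : ℝ) (bit : Bool) : ℕ × DivideState :=
  let res := ((lrStep st.lr x).run fun _ => bit).1
  (st.setup.markedServers.getD res.1 0, { st with past := st.past ++ [x], lr := res.2 })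

/-- Serve an unmarked request of block `i` by `A`, run on the unmarked servers and requests of this
block. -/
def divideUnmarkedStep (A : OnlineAlg) (st : DivideState) (x : ℝ) : ℕ × DivideState :=
  let D := st.setup
  let i := D.block x
  let j := A (D.positions (D.unmarkedServers i)) (st.unmarked i) x
  ((D.unmarkedServers i).getD j 0,
    { st with
      past := st.past ++ [x]
      unmarked := Function.update st.unmarked i (st.unmarked i ++ [x]) })

def divideStep (A : OnlineAlg) (st : DivideState) (x : ℝ) : ℕ × DivideState :=
  match st.setup.mark st.past x with
  | .unmarked => divideUnmarkedStep A st x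
  | .right => divideMarkedStep st x true
  | .left => divideMarkedStep st x false

/-- Algorithm DIVIDE with `k` blocks and subroutine `A`, for servers in `[1, N - 1]`, the first one at
`1`, and for integer requests. -/
def DIVIDE (A : OnlineAlg) (k N : ℕ) : AdviceAlg where
  State := DivideState
  init := divideInit k N
  step st x := pure (divideStep A st x)

/-! ### Algorithm RESCALE -/

/-- `s' = n³ (s - s_1) + 1`. -/
def rescaleServer (s : List ℝ) (x : ℝ) : ℝ := (s.length : ℝ) ^ 3 * (x - s.headD 0) + 1

/-- `r' = ⌊n³ (r - s_1)⌋ + 1`. -/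
def rescaleRequest (s : List ℝ) (x : ℝ) : ℝ := ⌊(s.length : ℝ) ^ 3 * (x - s.headD 0)⌋ + 1

/-- `N = ⌈s'_n - s'_1⌉ + 2`. -/
def rescaleN (s : List ℝ) : ℕ := ⌈serverSpan (s.map (rescaleServer s))⌉₊ + 2

/-- Algorithm RESCALE: DIVIDE on the rescaled servers and the rescaled and rounded requests. -/
def RESCALE (A : OnlineAlg) (k : ℕ) : AdviceAlg where
  State := (s : List ℝ) × (DIVIDE A k (rescaleN s)).State
  init s := do
    let st ← (DIVIDE A k (rescaleN s)).init (s.map (rescaleServer s))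
    pure ⟨s, st⟩
  step st x := do
    let res ← (DIVIDE A k (rescaleN st.1)).step st.2 (rescaleRequest st.1 x)
    pure (res.1, ⟨st.1, res.2⟩)

end

noncomputable section

/-! ### Programs that read a given word -/

namespace AdviceProg

/-! The advice describes one particular optimal matching. Sort the requests by their cut-off
positions and give the request of rank `j` the server of index `j`. This is optimal because
distances between two sorted sequences form a Monge array, whose diagonal is a minimal assignment
(`sum_diag_le_sum_perm_of_monge`, `sum_optServer_le`). Cutting off can reverse the order of two
requests only if both lie outside the range of the servers on the same side, and there the order is
irrelevant.

Ties at one position are broken by `monoRank` so that, in order of arrival, first come the requests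
that stay in their block, then those served from the right, then those served from the left. This is
the order that DIVIDE presupposes, so the words q and d reproduce the marks (`mark_eq_rankMark`).
Ranks run block after block: the requests of one block fill an interval of ranks, those leaving to
the left at its lower end and those leaving to the right at its upper end. Hence the counts m mark
exactly the servers of the marked requests (`mem_foldl_markR`, `mem_foldl_markL`), and the input
splits into independent balanced problems: the marked one, and one for each block.

On the marked problem LR costs no more than the monotone matching. This is an exchange argument
(`LRPlan.lr_le`): whenever LR deviates from the current plan, two servers are swapped in the plan,
which stays consistent with the marks and does not get more expensive. On each block, which has at
most ⌈n/k⌉ servers, the subroutine is competitive against the share of the monotone matching in this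
block. Since a competitive ratio is at least 1 (`one_le_of_isCompetitive`), the pieces add up to
c(⌈n/k⌉) times the optimum plus k times the additive constant (`integral_sum_answer_le`).

Rescaling by n³ and rounding changes each distance by at most 1 on the enlarged scale. The resulting
errors c(⌈n/k⌉)·n and n, and the additive constants of the at most n blocks, are all O(n³) because
c(n) = O(n²); dividing by n³ leaves a constant. The advice has at most 2(k-1) words for positions
and 4(k-1) numbers up to n, and log N ≤ 4 log n + log⁺(s_n - s_1) for n ≥ 2. -/

def consTape (b : Bool) (φ : ℕ → Bool) : ℕ → Bool
  | 0 => b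
  | i + 1 => φ i

/-- On every tape that begins with the word `l`, the program reads exactly `l` and returns `b`. -/
def Reads {β : Type} (p : AdviceProg β) (l : List Bool) (b : β) : Prop :=
  ∀ φ, p.run (l.foldr consTape φ) = (b, l.length)

theorem reads_pure {β : Type} (b : β) : Reads (pure b) [] b := fun _ => rfl

theorem reads_read {β : Type} {next : Bool → AdviceProg β} {bit : Bool} {l : List Bool} {b : β}
    (h : Reads (next bit) l b) : Reads (read next) (bit :: l) b := by
  intro φ
  have := h φ
  simp only [List.foldr_cons, run, List.length_cons]
  change (((next bit).run (l.foldr consTape φ)).1, ((next bit).run (l.foldr consTape φ)).2 + 1) = _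
  rw [this]

theorem Reads.bind {β γ : Type} {p : AdviceProg β} {f : β → AdviceProg γ} {l l' : List Bool}
    {b : β} {c : γ} (hp : Reads p l b) (hf : Reads (f b) l' c) : Reads (p >>= f) (l ++ l') c := by
  induction p generalizing l with
  | ret b' =>
    have h := hp fun _ => false
    simp only [run, Prod.mk.injEq] at h
    obtain ⟨rfl, h⟩ := h
    obtain rfl : l = [] := List.length_eq_zero_iff.1 h.symm
    exact hf
  | read next ih =>
    have h := hp fun _ => false
    cases l with
    | nil => simp [run] at h
    | cons bit t =>
      refine reads_read (next := fun bit => (next bit).andThen f) (ih bit ?_)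
      intro φ
      have h := hp φ
      simp only [List.foldr_cons, run, List.length_cons, Prod.mk.injEq, Nat.add_right_cancel_iff] at h
      exact Prod.ext h.1 h.2

theorem Reads.map {β γ : Type} {p : AdviceProg β} {l : List Bool} {b : β} (hp : Reads p l b)
    (g : β → γ) : Reads (p >>= fun b => pure (g b)) l (g b) := by
  simpa using hp.bind (f := fun b => pure (g b)) (reads_pure (g b))

theorem run_bind_pure {β γ : Type} (p : AdviceProg β) (g : β → γ) (φ : ℕ → Bool) :
    (p >>= fun b => pure (g b)).run φ = (g (p.run φ).1, (p.run φ).2) := by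
  induction p generalizing φ with
  | ret b => rfl
  | read next ih =>
    change (read fun bit => next bit >>= fun b => pure (g b)).run φ = _
    simp [run, ih]

theorem exists_reads_readWord (w v : ℕ) (hv : v < 2 ^ w) :
    ∃ l : List Bool, l.length = w ∧ Reads (readWord w) l v := by
  induction w generalizing v with
  | zero =>
    obtain rfl : v = 0 := by simpa using hv
    exact ⟨[], rfl, reads_pure 0⟩
  | succ w ih =>
    have hmod : v % 2 ^ w < 2 ^ w := Nat.mod_lt _ (by positivity)
    obtain ⟨l, hl, h⟩ := ih (v % 2 ^ w) hmod
    have hdiv : v / 2 ^ w < 2 := by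
      rw [Nat.div_lt_iff_lt_mul (by positivity)]
      rw [pow_succ] at hv
      omega
    have hb : (decide (v / 2 ^ w = 1)).toNat = v / 2 ^ w := by
      interval_cases v / 2 ^ w <;> rfl
    refine ⟨decide (v / 2 ^ w = 1) :: l, by simp [hl], ?_⟩
    have := reads_read (next := fun bit => do
      let v ← readWord w
      pure (bit.toNat * 2 ^ w + v)) (h.map fun u => (decide (v / 2 ^ w = 1)).toNat * 2 ^ w + u)
    rw [hb, Nat.div_add_mod'] at this
    exact this

theorem exists_reads_forIndices {β : Type} (b₀ : β) (f : ℕ → AdviceProg β) (g : ℕ → β) (W : ℕ)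
    (is : List ℕ) (h : ∀ i ∈ is, ∃ l : List Bool, l.length ≤ W ∧ Reads (f i) l (g i))
    (hg : ∀ i ∉ is, g i = b₀) :
    ∃ l : List Bool, l.length ≤ is.length * W ∧ Reads (forIndices b₀ f is) l g := by
  -- The condition outside the list does not survive passing to the tail, so the induction uses the
  -- restriction of `g` to the current list.
  suffices H : ∃ l : List Bool, l.length ≤ is.length * W ∧
      Reads (forIndices b₀ f is) l (fun i => if i ∈ is then g i else b₀) by
    convert H using 5 with l i
    split_ifs with hi
    · rfl
    · exact hg i hi
  clear hg
  induction is with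
  | nil => exact ⟨[], by simp, fun _ => by simp [forIndices]; rfl⟩
  | cons i is ih =>
    obtain ⟨l₁, hl₁, h₁⟩ := h i (by simp)
    obtain ⟨l₂, hl₂, h₂⟩ := ih fun j hj => h j (by simp [hj])
    refine ⟨l₁ ++ l₂, ?_, ?_⟩
    · rw [List.length_append, List.length_cons, Nat.succ_mul]
      omega
    · refine h₁.bind ?_
      have := h₂.map fun g' => Function.update g' i (g i)
      convert this using 1
      ext j
      by_cases hj : j = i
      · subst hj; simp
      · simp [hj]

end AdviceProg

/-! ### The advice word of DIVIDE -/

open AdviceProg in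
-- The hypotheses make decoding faithful. The word 0 and the all-1 word, which is at least `N`, are
-- reserved for "none", so positions must satisfy `0 < q` on the left and `q < N` on the right;
-- numbers that are not read must have the default value 0; all others must fit into their words.
theorem exists_reads_divideRead (D : DivideSetup)
    (hL : ∀ i q, D.qL i = some q → 1 < i ∧ i ≤ D.k ∧ 0 < q ∧ q ≤ D.N)
    (hR : ∀ i q, D.qR i = some q → 0 < i ∧ i < D.k ∧ q < D.N)
    (hL' : ∀ i, D.qL i = none → D.dL i = 0 ∧ D.mL i = 0)
    (hR' : ∀ i, D.qR i = none → D.dR i = 0 ∧ D.mR i = 0)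
    (hdL : ∀ i, D.dL i ≤ D.n) (hmL : ∀ i, D.mL i ≤ D.n)
    (hdR : ∀ i, D.dR i ≤ D.n) (hmR : ∀ i, D.mR i ≤ D.n) :
    ∃ l : List Bool, l.length ≤ (D.k - 1) * (2 * Nat.size D.N + 4 * Nat.size D.n) ∧
      Reads (divideRead D.k D.N D.servers) l D := by
  have hN : D.N < 2 ^ Nat.size D.N := Nat.lt_size_self D.N
  have hn : D.n < 2 ^ Nat.size D.n := Nat.lt_size_self D.n
  obtain ⟨l₁, hl₁, h₁⟩ := exists_reads_forIndices none (fun _ => do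
    let q ← readWord (Nat.size D.N)
    pure (if q = 0 then none else some q)) D.qL (Nat.size D.N) (List.Ico 2 (D.k + 1))
    (by
      intro i _
      cases hq : D.qL i with
      | none =>
        obtain ⟨l, hl, h⟩ := exists_reads_readWord (Nat.size D.N) 0 (by positivity)
        exact ⟨l, hl.le, by simpa using h.map fun q => if q = 0 then none else some q⟩
      | some q =>
        obtain ⟨l, hl, h⟩ := exists_reads_readWord (Nat.size D.N) q (by have := hL i q hq; omega)
        refine ⟨l, hl.le, ?_⟩
        have h0 : q ≠ 0 := by have := hL i q hq; omega
        simpa [h0] using h.map fun q => if q = 0 then none else some q)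
    (by
      intro i hi
      cases hq : D.qL i with
      | none => rfl
      | some q =>
        have := hL i q hq
        simp at hi
        omega)
  obtain ⟨l₂, hl₂, h₂⟩ := exists_reads_forIndices none (fun _ => do
    let q ← readWord (Nat.size D.N)
    pure (if q = 2 ^ Nat.size D.N - 1 then none else some q)) D.qR (Nat.size D.N) (List.Ico 1 D.k)
    (by
      intro i _
      cases hq : D.qR i with
      | none =>
        obtain ⟨l, hl, h⟩ := exists_reads_readWord (Nat.size D.N) (2 ^ Nat.size D.N - 1) (by omega)
        exact ⟨l, hl.le, by
          simpa using h.map fun q => if q = 2 ^ Nat.size D.N - 1 then none else some q⟩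
      | some q =>
        obtain ⟨l, hl, h⟩ := exists_reads_readWord (Nat.size D.N) q (by have := hR i q hq; omega)
        refine ⟨l, hl.le, ?_⟩
        have h0 : q ≠ 2 ^ Nat.size D.N - 1 := by have := hR i q hq; omega
        simpa [h0] using h.map fun q => if q = 2 ^ Nat.size D.N - 1 then none else some q)
    (by
      intro i hi
      cases hq : D.qR i with
      | none => rfl
      | some q =>
        have := hR i q hq
        simp at hi
        omega)
  -- A copy of the local program in `divideRead`, so that the four pieces fit together
  -- definitionally.
  let readPair : Option ℕ → AdviceProg (ℕ × ℕ) := fun q =>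
    match q with
    | none => pure (0, 0)
    | some _ => do
        let d ← AdviceProg.readWord (Nat.size D.n)
        let m ← AdviceProg.readWord (Nat.size D.n)
        pure (d, m)
  have hpair : ∀ (q : Option ℕ) (d m : ℕ), (q = none → d = 0 ∧ m = 0) → d ≤ D.n → m ≤ D.n →
      ∃ l : List Bool, l.length ≤ 2 * Nat.size D.n ∧ Reads (readPair q) l (d, m) := by
    intro q d m h0 hd hm
    cases q with
    | none =>
      obtain ⟨rfl, rfl⟩ := h0 rfl
      exact ⟨[], by simp, reads_pure _⟩
    | some q =>
      obtain ⟨l, hl, h⟩ := exists_reads_readWord (Nat.size D.n) d (by omega)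
      obtain ⟨l', hl', h'⟩ := exists_reads_readWord (Nat.size D.n) m (by omega)
      exact ⟨l ++ l', by simp [hl, hl']; omega, h.bind (h'.map fun m => (d, m))⟩
  obtain ⟨l₃, hl₃, h₃⟩ := exists_reads_forIndices (0, 0) (fun i => readPair (D.qR i))
    (fun i => (D.dR i, D.mR i)) (2 * Nat.size D.n) (List.Ico 1 D.k)
    (fun i _ => hpair _ _ _ (hR' i) (hdR i) (hmR i))
    (by
      intro i hi
      have : D.qR i = none := by
        cases hq : D.qR i with
        | none => rfl
        | some q =>
          have := hR i q hq
          simp at hi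
          omega
      simp [hR' i this])
  obtain ⟨l₄, hl₄, h₄⟩ := exists_reads_forIndices (0, 0) (fun i => readPair (D.qL i))
    (fun i => (D.dL i, D.mL i)) (2 * Nat.size D.n) (List.Ico 2 (D.k + 1)).reverse
    (fun i _ => hpair _ _ _ (hL' i) (hdL i) (hmL i))
    (by
      intro i hi
      have : D.qL i = none := by
        cases hq : D.qL i with
        | none => rfl
        | some q =>
          have := hL i q hq
          simp at hi
          omega
      simp [hL' i this])
  refine ⟨l₁ ++ (l₂ ++ (l₃ ++ l₄)), ?_, ?_⟩
  · simp only [List.Ico.length, List.length_reverse, List.length_append] at *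
    have : D.k + 1 - 2 = D.k - 1 := by omega
    rw [this] at hl₁ hl₄
    nlinarith
  · exact h₁.bind (h₂.bind (h₃.bind (h₄.map _)))


/-! ### The diagonal of a Monge array -/

/-- Uncross at the largest index `a`: if `b` is sent to `a`, the Monge inequality allows sending `a`
to itself and `b` to the old image of `a`. The rest is the same problem without `a`. -/
theorem sum_diag_le_sum_perm_of_monge {α : Type*} [LinearOrder α] (W : α → α → ℝ)
    (t : Finset α) (hW : ∀ i ∈ t, ∀ i' ∈ t, ∀ j ∈ t, ∀ j' ∈ t, i < i' → j < j' →
      W i j + W i' j' ≤ W i j' + W i' j)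
    (f : α → α) (hf : Set.MapsTo f t t) (hinj : Set.InjOn f t) :
    ∑ i ∈ t, W i i ≤ ∑ i ∈ t, W i (f i) := by
  classical
  induction t using Finset.induction_on_max generalizing f with
  | empty => simp
  | insert a t hmax ih =>
    have ha : a ∉ t := fun h => lt_irrefl _ (hmax a h)
    have ih := ih fun i hi i' hi' j hj j' hj' => hW i (by simp [hi]) i' (by simp [hi']) j
      (by simp [hj]) j' (by simp [hj'])
    have hsurj := Finset.surjOn_of_injOn_of_card_le f hf hinj le_rfl
    obtain ⟨b, hb, hba⟩ := hsurj (by simp : a ∈ (↑(insert a t) : Set α))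
    rw [Finset.sum_insert ha, Finset.sum_insert ha]
    by_cases hab : b = a
    · subst hab
      rw [hba]
      refine add_le_add le_rfl ?_
      refine ih f (fun i hi => ?_) (hinj.mono (by simp))
      have h1 := hf (by simp [Finset.mem_coe.1 hi] : i ∈ (↑(insert b t) : Set α))
      have h2 : f i ≠ b := by
        intro h
        have := hinj (by simp [Finset.mem_coe.1 hi]) hb (h.trans hba.symm)
        exact ha (this ▸ Finset.mem_coe.1 hi)
      simpa [h2] using h1
    · have hbt : b ∈ t := by simpa [hab] using hb
      have hfa : f a ≠ a := fun h => hab (hinj hb (by simp) (hba.trans h.symm))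
      have hfat : f a ∈ t := by simpa [hfa] using hf (by simp : a ∈ (↑(insert a t) : Set α))
      -- The uncrossed map, which preserves `t`.
      have key := ih (Function.update f b (f a)) (fun i hi => by
          by_cases hib : i = b
          · subst hib; simpa using hfat
          · have hi' : i ∈ t := hi
            have h1 := hf (by simp [hi'] : i ∈ (↑(insert a t) : Set α))
            have h2 : f i ≠ a := by
              intro h
              exact hib (hinj (by simp [hi']) hb (h.trans hba.symm))
            simpa [Function.update_of_ne hib, h2] using h1)
        (by
          intro i hi j hj hij
          have hi' : i ∈ t := hi
          have hj' : j ∈ t := hj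
          by_cases hib : i = b <;> by_cases hjb : j = b
          · rw [hib, hjb]
          · subst hib
            rw [Function.update_self, Function.update_of_ne hjb] at hij
            exact absurd (hinj (by simp) (by simp [hj']) hij) (fun h => ha (h ▸ hj'))
          · subst hjb
            rw [Function.update_self, Function.update_of_ne hib] at hij
            exact absurd (hinj (by simp [hi']) (by simp) hij) (fun h => ha (h ▸ hi'))
          · rw [Function.update_of_ne hib, Function.update_of_ne hjb] at hij
            exact hinj (by simp [hi']) (by simp [hj']) hij)
      rw [← Finset.add_sum_erase t (fun i => W i (Function.update f b (f a) i)) hbt] at key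
      rw [← Finset.add_sum_erase t (fun i => W i (f i)) hbt, hba]
      have hcongr : ∑ i ∈ t.erase b, W i (Function.update f b (f a) i) =
          ∑ i ∈ t.erase b, W i (f i) :=
        Finset.sum_congr rfl fun i hi => by rw [Function.update_of_ne (Finset.ne_of_mem_erase hi)]
      rw [hcongr, Function.update_self] at key
      have := hW b (by simp [hbt]) a (by simp) (f a) (by simp [hfat]) a (by simp) (hmax b hbt)
        (hmax _ hfat)
      linarith

/-! ### The exchange argument for LR -/

theorem lrStep_run (st : List (ℕ × ℝ)) (x : ℝ) (φ : ℕ → Bool) :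
    ((lrStep st x).run φ).1 =
      (((lrChoose st x).run φ).1, st.filter fun p => p.1 ≠ ((lrChoose st x).run φ).1) := by
  unfold lrStep
  rw [AdviceProg.run_bind_pure]

/-- With bit 1 it does not matter whether LR really reads the bit: without a server on the left it
goes right anyway. In the sorted state the first server to the right is the nearest one. -/
theorem exists_lrChoose_right {st : List (ℕ × ℝ)} (hst : st.Pairwise (fun p q => p.2 ≤ q.2)) {x : ℝ}
    (hx : ∃ p ∈ st, x ≤ p.2) :
    ∃ p ∈ st, ((lrChoose st x).run fun _ => true).1 = p.1 ∧ x ≤ p.2 ∧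
      ∀ p' ∈ st, x ≤ p'.2 → p.2 ≤ p'.2 := by
  unfold lrChoose
  cases h : st.filter (fun p => p.2 = x) with
  | cons p l =>
    have hp : p ∈ st.filter (fun p => p.2 = x) := by simp [h]
    simp only [List.mem_filter, decide_eq_true_eq] at hp
    exact ⟨p, hp.1, rfl, hp.2.ge, fun p' _ h' => hp.2.le.trans h'⟩
  | nil =>
    have hne : ∀ p ∈ st, p.2 ≠ x := by simpa [List.filter_eq_nil_iff] using h
    obtain ⟨p₀, hp₀, hxp₀⟩ := hx
    have hlt := lt_of_le_of_ne hxp₀ (hne p₀ hp₀).symm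
    have hs := List.Pairwise.filter (fun p : ℕ × ℝ => decide (x < p.2)) hst
    cases hg : st.filter (fun p => x < p.2) with
    | nil => simp only [List.filter_eq_nil_iff, decide_eq_true_eq] at hg; exact absurd hlt (hg p₀ hp₀)
    | cons q l =>
      have hq : q ∈ st.filter (fun p => x < p.2) := by simp [hg]
      simp only [List.mem_filter, decide_eq_true_eq] at hq
      refine ⟨q, hq.1, ?_, hq.2.le, fun p' hp' hxp' => ?_⟩
      · cases hl : (st.filter (fun p => p.2 < x)).getLast? <;> rfl
      · have hmem : p' ∈ st.filter (fun p => x < p.2) := by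
          simp only [List.mem_filter, decide_eq_true_eq]
          exact ⟨hp', lt_of_le_of_ne hxp' (hne p' hp').symm⟩
        rw [hg] at hmem hs
        rcases List.mem_cons.1 hmem with rfl | hmem
        · exact le_rfl
        · exact (List.pairwise_cons.1 hs).1 _ hmem

theorem exists_lrChoose_left {st : List (ℕ × ℝ)} (hst : st.Pairwise (fun p q => p.2 ≤ q.2)) {x : ℝ}
    (hx : ∃ p ∈ st, p.2 ≤ x) :
    ∃ p ∈ st, ((lrChoose st x).run fun _ => false).1 = p.1 ∧ p.2 ≤ x ∧
      ∀ p' ∈ st, p'.2 ≤ x → p'.2 ≤ p.2 := by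
  unfold lrChoose
  cases h : st.filter (fun p => p.2 = x) with
  | cons p l =>
    have hp : p ∈ st.filter (fun p => p.2 = x) := by simp [h]
    simp only [List.mem_filter, decide_eq_true_eq] at hp
    exact ⟨p, hp.1, rfl, hp.2.le, fun p' _ h' => h'.trans hp.2.ge⟩
  | nil =>
    have hne : ∀ p ∈ st, p.2 ≠ x := by simpa [List.filter_eq_nil_iff] using h
    obtain ⟨p₀, hp₀, hxp₀⟩ := hx
    have hlt := lt_of_le_of_ne hxp₀ (hne p₀ hp₀)
    have hs := List.Pairwise.filter (fun p : ℕ × ℝ => decide (p.2 < x)) hst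
    rcases List.eq_nil_or_concat' (st.filter (fun p => p.2 < x)) with hg | ⟨l, q, hg⟩
    · simp only [List.filter_eq_nil_iff, decide_eq_true_eq] at hg; exact absurd hlt (hg p₀ hp₀)
    · have hq : q ∈ st.filter (fun p => p.2 < x) := by simp [hg]
      simp only [List.mem_filter, decide_eq_true_eq] at hq
      refine ⟨q, hq.1, ?_, hq.2.le, fun p' hp' hxp' => ?_⟩
      · rw [hg]
        cases hl : (st.filter (fun p => x < p.2)).head? <;> simp [AdviceProg.run] <;> rfl
      · have hmem : p' ∈ st.filter (fun p => p.2 < x) := by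
          simp only [List.mem_filter, decide_eq_true_eq]
          exact ⟨hp', lt_of_le_of_ne hxp' (hne p' hp')⟩
        rw [hg] at hmem hs
        rcases List.mem_append.1 hmem with hmem | hmem
        · exact (List.pairwise_append.1 hs).2.2 _ hmem _ (by simp)
        · rw [List.mem_singleton.1 hmem]

open Classical in
/-- The marked requests with indices from `a` to `n - 1`. -/
def markedFrom (M : ℕ → Mark) (n a : ℕ) : Finset ℕ :=
  (Finset.Ico a n).filter fun b => M b ≠ .unmarked

theorem mem_markedFrom {M : ℕ → Mark} {n a b : ℕ} :
    b ∈ markedFrom M n a ↔ (a ≤ b ∧ b < n) ∧ M b ≠ .unmarked := by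
  simp [markedFrom]

theorem markedFrom_of_unmarked {M : ℕ → Mark} {n a : ℕ} (h : M a = .unmarked) :
    markedFrom M n a = markedFrom M n (a + 1) := by
  ext b
  simp only [mem_markedFrom]
  constructor
  · rintro ⟨⟨h1, h2⟩, h3⟩
    have : b ≠ a := fun e => h3 (e ▸ h)
    exact ⟨⟨by omega, h2⟩, h3⟩
  · rintro ⟨⟨h1, h2⟩, h3⟩
    exact ⟨⟨by omega, h2⟩, h3⟩

theorem notMem_markedFrom_succ {M : ℕ → Mark} {n a : ℕ} : a ∉ markedFrom M n (a + 1) := by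
  simp [mem_markedFrom]

theorem markedFrom_of_marked {M : ℕ → Mark} {n a : ℕ} (han : a < n) (h : M a ≠ .unmarked) :
    markedFrom M n a = insert a (markedFrom M n (a + 1)) := by
  ext b
  simp only [Finset.mem_insert, mem_markedFrom]
  constructor
  · rintro ⟨⟨h1, h2⟩, h3⟩
    by_cases hb : b = a
    · exact Or.inl hb
    · exact Or.inr ⟨⟨by omega, h2⟩, h3⟩
  · rintro (rfl | ⟨⟨h1, h2⟩, h3⟩)
    · exact ⟨⟨le_rfl, han⟩, h⟩
    · exact ⟨⟨by omega, h2⟩, h3⟩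

/-- `τ` matches the marked requests from index `a` on with the servers of the LR state `st` in
accordance with the marks. -/
structure LRPlan (M : ℕ → Mark) (x V : ℕ → ℝ) (n a : ℕ) (st : List (ℕ × ℝ)) (τ : ℕ → ℕ) :
    Prop where
  sorted : st.Pairwise (fun p q => p.2 ≤ q.2)
  val : ∀ p ∈ st, p.2 = V p.1
  mem : ∀ b ∈ markedFrom M n a, (τ b, V (τ b)) ∈ st
  inj : Set.InjOn τ (markedFrom M n a)
  right : ∀ b ∈ markedFrom M n a, M b = .right → x b ≤ V (τ b)
  left : ∀ b ∈ markedFrom M n a, M b = .left → V (τ b) < x b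
  cross : ∀ b ∈ markedFrom M n a, ∀ c ∈ markedFrom M n a, M b = .right → M c = .left →
    V (τ b) ≤ V (τ c) ∨ x c ≤ x b

/-- Give the server `q` to the current request `a`, and the server planned for `a` to the request for
which `q` was planned. -/
def swapPlan (τ : ℕ → ℕ) (a q : ℕ) (b : ℕ) : ℕ := if τ b = q then τ a else τ b

/-- The planned server of `a` shows that a server on the marked side is still available, so LR goes
to that side and stops at the planned server or before it. -/
theorem LRPlan.exists_chosen {M : ℕ → Mark} {x V : ℕ → ℝ} {n a : ℕ} {st : List (ℕ × ℝ)} {τ : ℕ → ℕ}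
    (h : LRPlan M x V n a st τ) (han : a < n) {q : ℕ}
    (hr : M a = .right → q = ((lrChoose st (x a)).run fun _ => true).1)
    (hl : M a = .left → q = ((lrChoose st (x a)).run fun _ => false).1)
    (hm : M a ≠ .unmarked) :
    (q, V q) ∈ st ∧ (M a = .right → x a ≤ V q ∧ V q ≤ V (τ a)) ∧
      (M a = .left → V q ≤ x a ∧ V (τ a) ≤ V q) := by
  have ha : a ∈ markedFrom M n a := mem_markedFrom.2 ⟨⟨le_rfl, han⟩, hm⟩
  cases hMa : M a with
  | unmarked => exact absurd hMa hm
  | right =>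
    have hxa := h.right a ha hMa
    obtain ⟨p, hp, hpq, hxp, hmin⟩ := exists_lrChoose_right h.sorted ⟨_, h.mem a ha, hxa⟩
    obtain rfl : q = p.1 := (hr hMa).trans hpq
    have hv := h.val p hp
    refine ⟨by rw [← hv]; exact hp, fun _ => ⟨hv ▸ hxp, hv ▸ hmin _ (h.mem a ha) hxa⟩, ?_⟩
    intro h; cases h
  | left =>
    have hxa := (h.left a ha hMa).le
    obtain ⟨p, hp, hpq, hxp, hmin⟩ := exists_lrChoose_left h.sorted ⟨_, h.mem a ha, hxa⟩
    obtain rfl : q = p.1 := (hl hMa).trans hpq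
    have hv := h.val p hp
    refine ⟨by rw [← hv]; exact hp, ?_, fun _ => ⟨hv ▸ hxp, hv ▸ hmin _ (h.mem a ha) hxa⟩⟩
    intro h; cases h

/-- If the server chosen by LR was planned for `w`, then either `w` has the same mark as the current
request or the two servers are at the same point. -/
theorem LRPlan.eq_mark_or_eq {M : ℕ → Mark} {x V : ℕ → ℝ} {n a : ℕ} {st : List (ℕ × ℝ)} {τ : ℕ → ℕ}
    (h : LRPlan M x V n a st τ) (han : a < n)
    (hO : ∀ b c, b < c → c < n → M b = .left → M c = .right → x b ≠ x c)
    (hm : M a ≠ .unmarked) {q w : ℕ} (hr : M a = .right → x a ≤ V q ∧ V q ≤ V (τ a))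
    (hl : M a = .left → V q ≤ x a ∧ V (τ a) ≤ V q)
    (hw : w ∈ markedFrom M n (a + 1)) (hwq : τ w = q) : M w = M a ∨ V q = V (τ a) := by
  have ha : a ∈ markedFrom M n a := mem_markedFrom.2 ⟨⟨le_rfl, han⟩, hm⟩
  have hw' : w ∈ markedFrom M n a := by rw [markedFrom_of_marked han hm]; simp [hw]
  have hwm := mem_markedFrom.1 hw
  subst hwq
  cases hMa : M a with
  | unmarked => exact absurd hMa hm
  | right =>
    cases hMw : M w with
    | unmarked => exact absurd hMw hwm.2
    | right => exact Or.inl rfl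
    | left =>
      right
      obtain ⟨h1, h2⟩ := hr hMa
      have h3 := h.left w hw' hMw
      rcases h.cross a ha w hw' hMa hMw with h4 | h4 <;> linarith
  | left =>
    cases hMw : M w with
    | unmarked => exact absurd hMw hwm.2
    | left => exact Or.inl rfl
    | right =>
      right
      obtain ⟨h1, h2⟩ := hl hMa
      have h3 := h.right w hw' hMw
      rcases h.cross w hw' a ha hMw hMa with h4 | h4
      · linarith
      -- Here `x w ≤ V q ≤ x a ≤ x w`, so a left request precedes a right one at the same point,
      -- which the tie rule excludes.
      · exact absurd (by linarith) (hO a w (by omega) hwm.1.2 hMa hMw)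

/-- If the request that loses `q` has the mark of `a`, it moves to a server at least as far out in
its own direction; otherwise the two servers are at one point and nothing changes. The delicate
clause is `cross`. -/
theorem LRPlan.swap {M : ℕ → Mark} {x V : ℕ → ℝ} {n a : ℕ} {st : List (ℕ × ℝ)} {τ : ℕ → ℕ}
    (h : LRPlan M x V n a st τ) (han : a < n)
    (hO : ∀ b c, b < c → c < n → M b = .left → M c = .right → x b ≠ x c)
    (hm : M a ≠ .unmarked) {q : ℕ} (hr : M a = .right → x a ≤ V q ∧ V q ≤ V (τ a))
    (hl : M a = .left → V q ≤ x a ∧ V (τ a) ≤ V q) :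
    LRPlan M x V n (a + 1) (st.filter fun p => p.1 ≠ q) (swapPlan τ a q) := by
  have ha : a ∈ markedFrom M n a := mem_markedFrom.2 ⟨⟨le_rfl, han⟩, hm⟩
  have hsub : ∀ b ∈ markedFrom M n (a + 1), b ∈ markedFrom M n a := fun b hb => by
    rw [markedFrom_of_marked han hm]; simp [hb]
  have hne : ∀ b ∈ markedFrom M n (a + 1), τ b ≠ τ a := fun b hb e =>
    notMem_markedFrom_succ (h.inj (hsub b hb) ha e ▸ hb)
  have heq : ∀ b ∈ markedFrom M n (a + 1), τ b = q → M b = M a ∨ V q = V (τ a) := fun b hb =>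
    h.eq_mark_or_eq han hO hm hr hl hb
  have hlt : ∀ b ∈ markedFrom M n (a + 1), a < b ∧ b < n := fun b hb => by
    have := mem_markedFrom.1 hb; omega
  constructor
  · exact h.sorted.filter _
  · exact fun p hp => h.val p (List.mem_of_mem_filter hp)
  · intro b hb
    simp only [swapPlan, List.mem_filter, decide_eq_true_eq]
    split_ifs with hbq
    · exact ⟨h.mem a ha, fun e => hne b hb (hbq.trans e.symm)⟩
    · exact ⟨h.mem b (hsub b hb), hbq⟩
  · intro b hb c hc hbc
    simp only [swapPlan] at hbc
    split_ifs at hbc with h1 h2 h2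
    · exact h.inj (hsub b hb) (hsub c hc) (h1.trans h2.symm)
    · exact absurd hbc.symm (hne c hc)
    · exact absurd hbc (hne b hb)
    · exact h.inj (hsub b hb) (hsub c hc) hbc
  · intro b hb hMb
    simp only [swapPlan]
    have h0 := h.right b (hsub b hb) hMb
    split_ifs with hbq
    · rcases heq b hb hbq with e | e
      · rw [hbq] at h0
        exact h0.trans (hr (e ▸ hMb)).2
      · rwa [← e, ← hbq]
    · exact h0
  · intro b hb hMb
    simp only [swapPlan]
    have h0 := h.left b (hsub b hb) hMb
    split_ifs with hbq
    · rcases heq b hb hbq with e | e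
      · rw [hbq] at h0
        exact (hl (e ▸ hMb)).2.trans_lt h0
      · rwa [← e, ← hbq]
    · exact h0
  · intro b hb c hc hMb hMc
    have h0 := h.cross b (hsub b hb) c (hsub c hc) hMb hMc
    simp only [swapPlan]
    split_ifs with h1 h2 h2
    · exact Or.inl le_rfl
    · rcases heq b hb h1 with e | e
      · have hMa : M a = .right := e ▸ hMb
        obtain ⟨h3, h4⟩ := hr hMa
        have h5 := h.cross a ha c (hsub c hc) hMa hMc
        have h6 := h.left c (hsub c hc) hMc
        rw [h1] at h0
        -- The only bad combination would give `V (τ c) < x c ≤ x a ≤ V q ≤ V (τ c)`.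
        rcases h5 with h5 | h5
        · exact Or.inl h5
        · rcases h0 with h0 | h0
          · linarith
          · exact Or.inr h0
      · rwa [← e, ← h1]
    · rcases heq c hc h2 with e | e
      · have hMa : M a = .left := e ▸ hMc
        obtain ⟨h3, h4⟩ := hl hMa
        have h5 := h.cross b (hsub b hb) a ha hMb hMa
        have h6 := h.right b (hsub b hb) hMb
        rw [h2] at h0
        rcases h5 with h5 | h5
        · exact Or.inl h5
        · rcases h0 with h0 | h0
          -- Now `x b ≤ V (τ b) ≤ V q ≤ x a ≤ x b`, and the tie rule applies again.
          · exact absurd (by linarith) (hO a b (hlt b hb).1 (hlt b hb).2 hMa hMb)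
          · exact Or.inr h0
      · rwa [← e, ← h2]
    · exact h0

/-- Two requests with the same mark have all four distances measured in one direction, so the swap
leaves their sum unchanged; for servers at one point this is trivial. If `q` was not planned for
anybody later, `a` only gets a nearer server. -/
theorem LRPlan.cost_swap_le {M : ℕ → Mark} {x V : ℕ → ℝ} {n a : ℕ} {st : List (ℕ × ℝ)} {τ : ℕ → ℕ}
    (h : LRPlan M x V n a st τ) (han : a < n)
    (hO : ∀ b c, b < c → c < n → M b = .left → M c = .right → x b ≠ x c)
    (hm : M a ≠ .unmarked) {q : ℕ} (hr : M a = .right → x a ≤ V q ∧ V q ≤ V (τ a))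
    (hl : M a = .left → V q ≤ x a ∧ V (τ a) ≤ V q) :
    |x a - V q| + ∑ b ∈ markedFrom M n (a + 1), |x b - V (swapPlan τ a q b)| ≤
      ∑ b ∈ markedFrom M n a, |x b - V (τ b)| := by
  have hsub : ∀ b ∈ markedFrom M n (a + 1), b ∈ markedFrom M n a := fun b hb => by
    rw [markedFrom_of_marked han hm]; simp [hb]
  rw [markedFrom_of_marked han hm, Finset.sum_insert notMem_markedFrom_succ]
  have hle : |x a - V q| ≤ |x a - V (τ a)| := by
    cases hMa : M a with
    | unmarked => exact absurd hMa hm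
    | right =>
      obtain ⟨h1, h2⟩ := hr hMa
      rw [abs_of_nonpos (by linarith), abs_of_nonpos (by linarith)]; linarith
    | left =>
      obtain ⟨h1, h2⟩ := hl hMa
      rw [abs_of_nonneg (by linarith), abs_of_nonneg (by linarith)]; linarith
  by_cases hw : ∃ w ∈ markedFrom M n (a + 1), τ w = q
  · obtain ⟨w, hw, hwq⟩ := hw
    rw [← Finset.add_sum_erase _ _ hw, ← Finset.add_sum_erase _ (fun b => |x b - V (τ b)|) hw]
    have hrest : ∑ b ∈ (markedFrom M n (a + 1)).erase w, |x b - V (swapPlan τ a q b)| =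
        ∑ b ∈ (markedFrom M n (a + 1)).erase w, |x b - V (τ b)| := by
      refine Finset.sum_congr rfl fun b hb => ?_
      have hbq : τ b ≠ q := fun e => Finset.ne_of_mem_erase hb
        (h.inj (hsub b (Finset.mem_of_mem_erase hb)) (hsub w hw) (e.trans hwq.symm))
      simp [swapPlan, hbq]
    rw [hrest]
    have hsw : swapPlan τ a q w = τ a := by simp [swapPlan, hwq]
    rw [hsw, hwq]
    rcases h.eq_mark_or_eq han hO hm hr hl hw hwq with e | e
    · cases hMa : M a with
      | unmarked => exact absurd hMa hm
      | right =>
        obtain ⟨h1, h2⟩ := hr hMa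
        have h3 := h.right w (hsub w hw) (e.trans hMa)
        rw [hwq] at h3
        rw [abs_of_nonpos (a := x a - V q) (by linarith),
          abs_of_nonpos (a := x w - V (τ a)) (by linarith),
          abs_of_nonpos (a := x a - V (τ a)) (by linarith),
          abs_of_nonpos (a := x w - V q) (by linarith)]
        linarith
      | left =>
        obtain ⟨h1, h2⟩ := hl hMa
        have h3 := h.left w (hsub w hw) (e.trans hMa)
        rw [hwq] at h3
        rw [abs_of_nonneg (a := x a - V q) (by linarith),
          abs_of_nonneg (a := x w - V (τ a)) (by linarith),
          abs_of_nonneg (a := x a - V (τ a)) (by linarith),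
          abs_of_nonneg (a := x w - V q) (by linarith)]
        linarith
    · rw [e]
  · push Not at hw
    refine add_le_add hle (Finset.sum_le_sum fun b hb => ?_)
    simp [swapPlan, hw b hb]

/-- LR, directed by the marks, is at least as good as every matching that accords with them. -/
theorem LRPlan.lr_le {M : ℕ → Mark} {x V : ℕ → ℝ} {n : ℕ} {st : ℕ → List (ℕ × ℝ)} {ch : ℕ → ℕ}
    (hO : ∀ b c, b < c → c < n → M b = .left → M c = .right → x b ≠ x c)
    (hu : ∀ a < n, M a = .unmarked → st (a + 1) = st a)
    (hm : ∀ a < n, M a ≠ .unmarked → st (a + 1) = (st a).filter fun p => p.1 ≠ ch a)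
    (hr : ∀ a < n, M a = .right → ch a = ((lrChoose (st a) (x a)).run fun _ => true).1)
    (hl : ∀ a < n, M a = .left → ch a = ((lrChoose (st a) (x a)).run fun _ => false).1)
    {a : ℕ} (han : a ≤ n) {τ : ℕ → ℕ} (h : LRPlan M x V n a (st a) τ) :
    (∀ b ∈ markedFrom M n a, (ch b, V (ch b)) ∈ st a) ∧ Set.InjOn ch (markedFrom M n a) ∧
      ∑ b ∈ markedFrom M n a, |x b - V (ch b)| ≤ ∑ b ∈ markedFrom M n a, |x b - V (τ b)| := by
  -- Backwards from the end: each step hands a swapped plan to the remaining requests, so the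
  -- statement is needed for all plans.
  induction han using Nat.decreasingInduction generalizing τ with
  | self =>
    have : markedFrom M n n = ∅ := by ext b; simp [mem_markedFrom]
    simp [this]
  | of_succ a han ih =>
    by_cases hMa : M a = .unmarked
    · rw [markedFrom_of_unmarked hMa, ← hu a han hMa]
      refine ih ?_
      rw [hu a han hMa]
      have e := markedFrom_of_unmarked (n := n) hMa
      exact ⟨h.sorted, h.val, e ▸ h.mem, e ▸ h.inj, e ▸ h.right, e ▸ h.left, e ▸ h.cross⟩
    · obtain ⟨h1, h2, h3⟩ := h.exists_chosen han (hr a han) (hl a han) hMa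
      have hs := h.swap han hO hMa h2 h3
      rw [← hm a han hMa] at hs
      obtain ⟨i1, i2, i3⟩ := ih hs
      have hc := h.cost_swap_le han hO hMa h2 h3
      have hmem : ∀ b ∈ markedFrom M n (a + 1), (ch b, V (ch b)) ∈ st a ∧ ch b ≠ ch a := by
        intro b hb
        have := i1 b hb
        rw [hm a han hMa] at this
        simpa using this
      refine ⟨?_, ?_, ?_⟩
      · intro b hb
        rw [markedFrom_of_marked han hMa] at hb
        rcases Finset.mem_insert.1 hb with rfl | hb
        · exact h1
        · exact (hmem b hb).1
      · rw [markedFrom_of_marked han hMa, Finset.coe_insert,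
          Set.injOn_insert (by simpa using notMem_markedFrom_succ)]
        refine ⟨i2, ?_⟩
        rintro ⟨b, hb, e⟩
        exact (hmem b hb).2 e
      · rw [markedFrom_of_marked han hMa, Finset.sum_insert notMem_markedFrom_succ,
          ← markedFrom_of_marked han hMa]
        linarith


/-! ### Ranks of requests in a monotone matching -/

/-- Requests `0, …, n - 1` with positions `P` and blocks `B`; the `i`-th block of servers ends at
`e i`. -/
structure IsBlockSystem (n k : ℕ) (P B e : ℕ → ℕ) : Prop where
  e_mono : Monotone e
  e_zero : e 0 = 0
  e_last : e k = n
  one_le_block : ∀ a < n, 1 ≤ B a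
  block_le : ∀ a < n, B a ≤ k
  block_mono : ∀ a < n, ∀ b < n, P a ≤ P b → B a ≤ B b

/-- The number of requests at positions below `y`. -/
def numBelow (n : ℕ) (P : ℕ → ℕ) (y : ℕ) : ℕ := ((Finset.range n).filter fun b => P b < y).card

/-- The number of earlier requests at the position of `a`. -/
def numEarlier (P : ℕ → ℕ) (a : ℕ) : ℕ := ((Finset.range a).filter fun b => P b = P a).card

/-- The number of requests in the blocks up to `i`. -/
def numUpTo (n : ℕ) (B : ℕ → ℕ) (i : ℕ) : ℕ := ((Finset.range n).filter fun b => B b ≤ i).card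

theorem numBelow_mono (n : ℕ) (P : ℕ → ℕ) : Monotone (numBelow n P) := fun _ _ h =>
  Finset.card_le_card (Finset.monotone_filter_right _ fun _ _ hb => lt_of_lt_of_le hb h)

theorem numBelow_le (n : ℕ) (P : ℕ → ℕ) (y : ℕ) : numBelow n P y ≤ n :=
  (Finset.card_filter_le _ _).trans (by simp)

theorem numUpTo_mono (n : ℕ) (B : ℕ → ℕ) : Monotone (numUpTo n B) := fun _ _ h =>
  Finset.card_le_card (Finset.monotone_filter_right _ fun _ _ hb => le_trans hb h)

theorem numUpTo_le (n : ℕ) (B : ℕ → ℕ) (i : ℕ) : numUpTo n B i ≤ n :=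
  (Finset.card_filter_le _ _).trans (by simp)

theorem numBelow_add_numEarlier_lt {n : ℕ} (P : ℕ → ℕ) {a : ℕ} (ha : a < n) :
    numBelow n P (P a) + numEarlier P a < numBelow n P (P a + 1) := by
  unfold numBelow numEarlier
  rw [← Finset.card_union_of_disjoint]
  · refine Finset.card_lt_card ⟨?_, ?_⟩
    · intro b hb
      simp only [Finset.mem_union, Finset.mem_filter, Finset.mem_range] at hb ⊢
      omega
    · intro h
      have := h (x := a) (by simp [ha])
      simp at this
  · rw [Finset.disjoint_left]
    intro b hb hb'
    simp only [Finset.mem_filter] at hb hb'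
    omega

theorem numEarlier_lt {P : ℕ → ℕ} {a b : ℕ} (hab : a < b) (h : P a = P b) :
    numEarlier P a < numEarlier P b := by
  unfold numEarlier
  refine Finset.card_lt_card ⟨?_, ?_⟩
  · intro c hc
    simp only [Finset.mem_filter, Finset.mem_range] at hc ⊢
    omega
  · intro h'
    have := h' (x := a) (by simp [hab, h])
    simp at this

section Rank

variable (n : ℕ) (P B e : ℕ → ℕ)

/-- The end of the servers of earlier blocks, within the ranks of the requests at the position of
`a`. -/
def cutL (a : ℕ) : ℕ := max (numBelow n P (P a)) (min (numBelow n P (P a + 1)) (e (B a - 1)))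

/-- The start of the servers of later blocks, within the ranks of the requests at the position of
`a`. -/
def cutR (a : ℕ) : ℕ := max (numBelow n P (P a)) (min (numBelow n P (P a + 1)) (e (B a)))

/-- The number of requests at the position of `a` that stay in their block. -/
def numStay (a : ℕ) : ℕ := cutR n P B e a - cutL n P B e a

/-- The number of requests at the position of `a` that are not served from the left. -/
def numNotLeft (a : ℕ) : ℕ := numBelow n P (P a + 1) - cutL n P B e a

/-- The server of request `a` in a monotone matching in which, among the requests at one position,
first those arrive that stay in their block, then those served from the right, then those served from
the left. -/
def monoRank (a : ℕ) : ℕ :=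
  if numEarlier P a < numNotLeft n P B e a then cutL n P B e a + numEarlier P a
  else numBelow n P (P a) + (numEarlier P a - numNotLeft n P B e a)

def rankMark (a : ℕ) : Mark :=
  if numEarlier P a < numStay n P B e a then .unmarked
  else if numEarlier P a < numNotLeft n P B e a then .right else .left

end Rank

theorem rank_bounds {n : ℕ} (P B e : ℕ → ℕ) {a : ℕ} (ha : a < n) :
    numBelow n P (P a) ≤ monoRank n P B e a ∧ monoRank n P B e a < numBelow n P (P a + 1) := by
  have h1 := numBelow_add_numEarlier_lt P ha
  unfold monoRank numNotLeft cutL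
  split_ifs <;> omega

theorem rank_lt {n : ℕ} (P B e : ℕ → ℕ) {a : ℕ} (ha : a < n) : monoRank n P B e a < n :=
  (rank_bounds P B e ha).2.trans_le (numBelow_le _ _ _)

theorem rank_lt_rank {n : ℕ} (P B e : ℕ → ℕ) {a b : ℕ} (ha : a < n) (hb : b < n) (hab : P a < P b) :
    monoRank n P B e a < monoRank n P B e b :=
  (rank_bounds P B e ha).2.trans_le ((numBelow_mono n P hab).trans (rank_bounds P B e hb).1)

theorem pos_le_of_rank_lt {n : ℕ} (P B e : ℕ → ℕ) {a b : ℕ} (ha : a < n) (hb : b < n)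
    (hab : monoRank n P B e a < monoRank n P B e b) : P a ≤ P b := by
  by_contra hc
  have := rank_lt_rank P B e hb ha (not_le.1 hc)
  omega

/-- The advice words for requests served from the right. -/
theorem exists_adviceR (n : ℕ) (P B e : ℕ → ℕ) (i : ℕ) : ∃ (q : Option ℕ) (d : ℕ),
    (∀ y, q = some y → ∃ a < n, B a = i ∧ e i ≤ monoRank n P B e a ∧ P a = y ∧
      d = numStay n P B e a) ∧
    (∀ b < n, B b = i → e i ≤ monoRank n P B e b → ∃ y, q = some y ∧ y ≤ P b) ∧
    (q = none → d = 0) := by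
  classical
  by_cases hne : ((Finset.range n).filter fun a => B a = i ∧ e i ≤ monoRank n P B e a).Nonempty
  · obtain ⟨a, ha, hmin⟩ := Finset.exists_min_image _ P hne
    simp only [Finset.mem_filter, Finset.mem_range] at ha hmin
    refine ⟨some (P a), numStay n P B e a, ?_, fun b hb h1 h2 => ⟨P a, rfl, hmin b ⟨hb, h1, h2⟩⟩,
      by simp⟩
    rintro y ⟨⟩
    exact ⟨a, ha.1, ha.2.1, ha.2.2, rfl, rfl⟩
  · refine ⟨none, 0, by simp, fun b hb h1 h2 => (hne ⟨b, ?_⟩).elim, by simp⟩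
    simp [hb, h1, h2]

/-- The advice words for requests served from the left. -/
theorem exists_adviceL (n : ℕ) (P B e : ℕ → ℕ) (i : ℕ) : ∃ (q : Option ℕ) (d : ℕ),
    (∀ y, q = some y → ∃ a < n, B a = i ∧ monoRank n P B e a < e (i - 1) ∧ P a = y ∧
      d = numNotLeft n P B e a) ∧
    (∀ b < n, B b = i → monoRank n P B e b < e (i - 1) → ∃ y, q = some y ∧ P b ≤ y) ∧
    (q = none → d = 0) := by
  classical
  by_cases hne : ((Finset.range n).filter fun a => B a = i ∧ monoRank n P B e a < e (i - 1)).Nonempty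
  · obtain ⟨a, ha, hmin⟩ := Finset.exists_max_image _ P hne
    simp only [Finset.mem_filter, Finset.mem_range] at ha hmin
    refine ⟨some (P a), numNotLeft n P B e a, ?_,
      fun b hb h1 h2 => ⟨P a, rfl, hmin b ⟨hb, h1, h2⟩⟩, by simp⟩
    rintro y ⟨⟩
    exact ⟨a, ha.1, ha.2.1, ha.2.2, rfl, rfl⟩
  · refine ⟨none, 0, by simp, fun b hb h1 h2 => (hne ⟨b, ?_⟩).elim, by simp⟩
    simp [hb, h1, h2]

/-! ### Marks and blocks read off from ranks -/

namespace IsBlockSystem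

variable {n k : ℕ} {P B e : ℕ → ℕ} (h : IsBlockSystem n k P B e)

include h

/-- `cutL` and `cutR` clamp the two ends of the block's servers to the ranks available at the
position. The early arrivals get the ranks between the cuts, the next ones those above `cutR`, the
last ones those below `cutL`. -/
theorem rankMark_eq {a : ℕ} (ha : a < n) :
    rankMark n P B e a = if monoRank n P B e a < e (B a - 1) then .left
      else if monoRank n P B e a < e (B a) then .unmarked else .right := by
  have h1 := numBelow_add_numEarlier_lt P ha
  have h2 : e (B a - 1) ≤ e (B a) := h.e_mono (by omega)
  unfold rankMark monoRank numStay numNotLeft cutL cutR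
  split_ifs <;> first | rfl | omega

theorem rankMark_eq_left {a : ℕ} (ha : a < n) :
    rankMark n P B e a = .left ↔ monoRank n P B e a < e (B a - 1) := by
  rw [h.rankMark_eq ha]
  split_ifs <;> simp_all

theorem rankMark_eq_right {a : ℕ} (ha : a < n) :
    rankMark n P B e a = .right ↔ e (B a) ≤ monoRank n P B e a := by
  have h2 : e (B a - 1) ≤ e (B a) := h.e_mono (by omega)
  rw [h.rankMark_eq ha]
  split_ifs <;> simp <;> omega

theorem rankMark_eq_unmarked {a : ℕ} (ha : a < n) :
    rankMark n P B e a = .unmarked ↔ e (B a - 1) ≤ monoRank n P B e a ∧ monoRank n P B e a < e (B a) := by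
  rw [h.rankMark_eq ha]
  split_ifs <;> simp <;> omega

theorem block_eq {a b : ℕ} (ha : a < n) (hb : b < n) (hab : P a = P b) : B a = B b :=
  le_antisymm (h.block_mono a ha b hb hab.le) (h.block_mono b hb a ha hab.ge)

theorem numStay_eq {a b : ℕ} (ha : a < n) (hb : b < n) (hab : P a = P b) :
    numStay n P B e a = numStay n P B e b := by
  unfold numStay cutL cutR
  rw [h.block_eq ha hb hab, hab]

theorem numNotLeft_eq {a b : ℕ} (ha : a < n) (hb : b < n) (hab : P a = P b) :
    numNotLeft n P B e a = numNotLeft n P B e b := by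
  unfold numNotLeft cutL
  rw [h.block_eq ha hb hab, hab]

theorem rank_injOn : Set.InjOn (monoRank n P B e) (Finset.range n) := by
  have key : ∀ a < n, ∀ b < n, a < b → P a = P b → monoRank n P B e a ≠ monoRank n P B e b := by
    intro a ha b hb hab hP
    have h1 := numEarlier_lt hab hP
    have h2 := numBelow_add_numEarlier_lt P ha
    have h3 := numBelow_add_numEarlier_lt P hb
    have h4 := h.block_eq ha hb hP
    rw [hP] at h2
    unfold monoRank numNotLeft cutL
    rw [hP, h4]
    split_ifs <;> omega
  intro a ha b hb hab
  simp only [Finset.coe_range, Set.mem_Iio] at ha hb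
  rcases lt_trichotomy (P a) (P b) with hP | hP | hP
  · exact absurd hab (rank_lt_rank P B e ha hb hP).ne
  · rcases lt_trichotomy a b with h' | h' | h'
    · exact absurd hab (key a ha b hb h' hP)
    · exact h'
    · exact absurd hab.symm (key b hb a ha h' hP.symm)
  · exact absurd hab (rank_lt_rank P B e hb ha hP).ne'

theorem exists_rank_eq {j : ℕ} (hj : j < n) : ∃ a < n, monoRank n P B e a = j := by
  have := Finset.surjOn_of_injOn_of_card_le (s := Finset.range n) (t := Finset.range n)
    (monoRank n P B e) (fun a ha => by simpa using rank_lt P B e (by simpa using ha)) h.rank_injOn le_rfl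
  obtain ⟨a, ha, hj⟩ := this (by simpa using hj : j ∈ (↑(Finset.range n) : Set ℕ))
  exact ⟨a, by simpa using ha, hj⟩

/-- At one position, no request served from the left precedes one served from the right. -/
theorem not_left_before_right {a b : ℕ} (hab : a < b) (hb : b < n) (hP : P a = P b)
    (hl : rankMark n P B e a = .left) (hr : rankMark n P B e b = .right) : False := by
  have h1 := numEarlier_lt hab hP
  have h2 := h.numStay_eq (hab.trans hb) hb hP
  have h3 := h.numNotLeft_eq (hab.trans hb) hb hP
  unfold rankMark at hl hr
  rw [h2, h3] at hl
  split_ifs at hl hr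
  omega

theorem numUpTo_le_rank {a : ℕ} (ha : a < n) : numUpTo n B (B a - 1) ≤ monoRank n P B e a := by
  refine le_trans (Finset.card_le_card ?_) (rank_bounds P B e ha).1
  intro b hb
  simp only [Finset.mem_filter, Finset.mem_range] at hb ⊢
  refine ⟨hb.1, ?_⟩
  by_contra hc
  have := h.block_mono a ha b hb.1 (not_lt.1 hc)
  have := h.one_le_block a ha
  omega

theorem rank_lt_numUpTo {a : ℕ} (ha : a < n) : monoRank n P B e a < numUpTo n B (B a) := by
  refine lt_of_lt_of_le (rank_bounds P B e ha).2 (Finset.card_le_card ?_)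
  intro b hb
  simp only [Finset.mem_filter, Finset.mem_range] at hb ⊢
  exact ⟨hb.1, h.block_mono b hb.1 a ha (by omega)⟩

/-- Requests are ranked block after block, so these intervals of ranks are disjoint for different
blocks. -/
theorem block_eq_of_rank {a i : ℕ} (ha : a < n) (h1 : numUpTo n B (i - 1) ≤ monoRank n P B e a)
    (h2 : monoRank n P B e a < numUpTo n B i) : B a = i := by
  have h3 := h.numUpTo_le_rank ha
  have h4 := h.rank_lt_numUpTo ha
  rcases lt_trichotomy (B a) i with hi | hi | hi
  · have := numUpTo_mono n B (show B a ≤ i - 1 by omega)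
    omega
  · exact hi
  · have := numUpTo_mono n B (show i ≤ B a - 1 by omega)
    omega

theorem numUpTo_zero : numUpTo n B 0 = 0 := by
  unfold numUpTo
  rw [Finset.card_eq_zero, Finset.filter_eq_empty_iff]
  intro a ha
  have := h.one_le_block a (by simpa using ha)
  omega

theorem numUpTo_last : numUpTo n B k = n := by
  unfold numUpTo
  rw [Finset.filter_true_of_mem (fun a ha => h.block_le a (by simpa using ha)), Finset.card_range]

open Classical in
/-- The advice words determine the marks. -/
theorem mark_eq_rankMark {qR qL : ℕ → Option ℕ} {dR dL : ℕ → ℕ}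
    (hqR : ∀ i y, qR i = some y → ∃ a < n, B a = i ∧ e i ≤ monoRank n P B e a ∧ P a = y ∧
      dR i = numStay n P B e a)
    (hqR' : ∀ b < n, e (B b) ≤ monoRank n P B e b → ∃ y, qR (B b) = some y ∧ y ≤ P b)
    (hqL : ∀ i y, qL i = some y → ∃ a < n, B a = i ∧ monoRank n P B e a < e (i - 1) ∧ P a = y ∧
      dL i = numNotLeft n P B e a)
    (hqL' : ∀ b < n, monoRank n P B e b < e (B b - 1) → ∃ y, qL (B b) = some y ∧ P b ≤ y)
    {a : ℕ} (ha : a < n) :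
    (if (∃ q, qR (B a) = some q ∧ q < P a) then Mark.right
      else if (∃ q, qL (B a) = some q ∧ P a < q) then .left
      else if qR (B a) = some (P a) ∧ qL (B a) = some (P a) then
        if numEarlier P a < dR (B a) then .unmarked
        else if numEarlier P a < dL (B a) then .right else .left
      else if qR (B a) = some (P a) then
        if numEarlier P a < dR (B a) then .unmarked else .right
      else if qL (B a) = some (P a) then
        if numEarlier P a < dL (B a) then .unmarked else .left
      else .unmarked) = rankMark n P B e a := by
  have hR : qR (B a) = some (P a) → dR (B a) = numStay n P B e a := fun hq => by
    obtain ⟨b, hb, _, _, hP, hd⟩ := hqR _ _ hq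
    rw [hd, h.numStay_eq hb ha hP]
  have hL : qL (B a) = some (P a) → dL (B a) = numNotLeft n P B e a := fun hq => by
    obtain ⟨b, hb, _, _, hP, hd⟩ := hqL _ _ hq
    rw [hd, h.numNotLeft_eq hb ha hP]
  have hr : rankMark n P B e a = .right → ∃ y, qR (B a) = some y ∧ y ≤ P a := fun hm =>
    hqR' a ha ((h.rankMark_eq_right ha).1 hm)
  have hl : rankMark n P B e a = .left → ∃ y, qL (B a) = some y ∧ P a ≤ y := fun hm =>
    hqL' a ha ((h.rankMark_eq_left ha).1 hm)
  have hstay : numStay n P B e a ≤ numNotLeft n P B e a := by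
    have h1 := numBelow_add_numEarlier_lt P ha
    unfold numStay numNotLeft cutR
    omega
  by_cases c1 : ∃ q, qR (B a) = some q ∧ q < P a
  · rw [if_pos c1]
    obtain ⟨q, hq, hqa⟩ := c1
    obtain ⟨b, hb, hB, hrk, rfl, -⟩ := hqR _ _ hq
    -- A request to the right of one served by a later block has a larger rank, hence is served by a
    -- later block too.
    exact ((h.rankMark_eq_right ha).2 (hrk.trans (rank_lt_rank P B e hb ha hqa).le)).symm
  rw [if_neg c1]
  by_cases c2 : ∃ q, qL (B a) = some q ∧ P a < q
  · rw [if_pos c2]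
    obtain ⟨q, hq, hqa⟩ := c2
    obtain ⟨b, hb, hB, hrk, rfl, -⟩ := hqL _ _ hq
    exact ((h.rankMark_eq_left ha).2 ((rank_lt_rank P B e ha hb hqa).trans hrk)).symm
  rw [if_neg c2]
  have hr' : rankMark n P B e a = .right → qR (B a) = some (P a) := fun hm => by
    obtain ⟨y, hy, hya⟩ := hr hm
    rcases hya.lt_or_eq with hlt | rfl
    · exact absurd ⟨y, hy, hlt⟩ c1
    · exact hy
  have hl' : rankMark n P B e a = .left → qL (B a) = some (P a) := fun hm => by
    obtain ⟨y, hy, hya⟩ := hl hm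
    rcases hya.lt_or_eq with hlt | rfl
    · exact absurd ⟨y, hy, hlt⟩ c2
    · exact hy
  clear hr hl
  by_cases r : qR (B a) = some (P a) <;> by_cases l : qL (B a) = some (P a)
  · simp only [r, l, and_self, if_true]
    rw [hR r, hL l]
    rfl
  -- Without `qL` at this position the request is not served from the left, so the last alternative
  -- of `rankMark` cannot occur.
  · have hl'' := fun hm => l (hl' hm)
    simp only [r, l, and_false, if_true, if_false]
    rw [hR r]
    unfold rankMark at hl'' ⊢
    split_ifs at hl'' ⊢ <;> simp_all
  -- The request is not served from the right, so "not from the left" means that it stays.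
  · have hr'' := fun hm => r (hr' hm)
    simp only [r, l, false_and, if_true, if_false]
    rw [hL l]
    unfold rankMark at hr'' ⊢
    split_ifs at hr'' ⊢ <;> first | rfl | omega | simp_all
  · have hr'' := fun hm => r (hr' hm)
    have hl'' := fun hm => l (hl' hm)
    simp only [r, l, false_and, if_false]
    cases hm : rankMark n P B e a <;> simp_all

end IsBlockSystem

/-! ### The marked servers -/

theorem mem_take_filter_range_ge {n g m j : ℕ} :
    j ∈ ((List.range n).filter fun j => g ≤ j).take m ↔ g ≤ j ∧ j < g + m ∧ j < n := by
  have : (List.range n).filter (fun j => g ≤ j) = List.range' g (n - g) := by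
    rw [← List.Ico.zero_bot, List.Ico.filter_le]
    simp [List.Ico]
  rw [this]
  rcases le_total (n - g) m with hm | hm
  · rw [List.take_range'_of_length_le hm, List.mem_range'_1]
    omega
  · rw [List.take_range'_of_length_ge hm, List.mem_range'_1]
    omega

theorem mem_take_filter_reverse_range_lt {n g m j : ℕ} (hg : g ≤ n) :
    j ∈ ((List.range n).reverse.filter fun j => j < g).take m ↔ g - m ≤ j ∧ j < g := by
  have : (List.range n).filter (fun j => j < g) = List.range g := by
    rw [← List.Ico.zero_bot, List.Ico.filter_lt, List.Ico.zero_bot, min_eq_right hg]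
  rw [List.filter_reverse, this, List.take_reverse, List.mem_reverse, List.length_range,
    List.range_eq_range', List.drop_range', List.mem_range'_1]
  omega

theorem exists_step_of_lt {f : ℕ → ℕ} {i j : ℕ} (h0 : f 0 ≤ j) (hi : j < f i) :
    ∃ l, 1 ≤ l ∧ l ≤ i ∧ f (l - 1) ≤ j ∧ j < f l := by
  induction i with
  | zero => omega
  | succ i ih =>
    by_cases hc : j < f i
    · obtain ⟨l, h1, h2, h3⟩ := ih hc
      exact ⟨l, h1, by omega, h3⟩
    · exact ⟨i + 1, by omega, le_rfl, by simpa using hc, hi⟩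

/-- Here `e i` counts the servers and `f i` the requests of the first `i` blocks. Among the servers
from `e i` on, those marked in earlier rounds are exactly the ones below `f (i - 1)`; so round `i`
continues at `max (e i) (f (i - 1))` and stops at `f i`. -/
theorem mem_foldl_markR {n k : ℕ} {e f : ℕ → ℕ} (he : Monotone e) (hf : Monotone f)
    (h0 : f 0 = 0) (hn : ∀ i, f i ≤ n) (j : ℕ) :
    j ∈ (List.Ico 1 k).foldl (fun M i => M ++
      ((List.range n).filter fun j => e i ≤ j ∧ j ∉ M).take (f i - max (e i) (f (i - 1)))) [] ↔
    ∃ i, 1 ≤ i ∧ i < k ∧ max (e i) (f (i - 1)) ≤ j ∧ j < f i := by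
  induction k generalizing j with
  | zero =>
    rw [List.Ico.eq_nil_of_le (by omega)]
    simp
  | succ k ih =>
    rcases Nat.eq_zero_or_pos k with rfl | hk
    · simp
    rw [List.Ico.succ_top hk, List.foldl_append]
    generalize (List.Ico 1 k).foldl _ [] = M at ih
    have hfil : ((List.range n).filter fun j => e k ≤ j ∧ j ∉ M) =
        (List.range n).filter fun j => max (e k) (f (k - 1)) ≤ j := by
      refine List.filter_congr fun j _ => ?_
      rw [decide_eq_decide, ih, max_le_iff]
      refine and_congr_right fun hj => ⟨fun hM => ?_, fun hj' => ?_⟩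
      · by_contra hc
        obtain ⟨l, h1, h2, h3, h4⟩ := exists_step_of_lt (by omega : f 0 ≤ j) (not_le.1 hc)
        have := he (show l ≤ k by omega)
        exact hM ⟨l, h1, by omega, by omega, h4⟩
      · rintro ⟨l, h1, h2, h3, h4⟩
        have := hf (show l ≤ k - 1 by omega)
        omega
    simp only [List.foldl_cons, List.foldl_nil]
    rw [List.mem_append, hfil, mem_take_filter_range_ge, ih]
    constructor
    · rintro (⟨i, h1, h2, h3⟩ | ⟨h1, h2, h3⟩)
      · exact ⟨i, h1, by omega, h3⟩
      · exact ⟨k, hk, by omega, h1, by omega⟩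
    · rintro ⟨i, h1, h2, h3, h4⟩
      by_cases hik : i = k
      · subst hik
        have := hn i
        exact Or.inr ⟨h3, by omega, by omega⟩
      · exact Or.inl ⟨i, h1, by omega, h3, h4⟩

/-- The mirror image: among the servers below `e (i - 1)`, those from `f i` on are already marked by
the rounds of larger index. -/
theorem mem_foldl_markL {n k : ℕ} {e f : ℕ → ℕ} (he : Monotone e) (hf : Monotone f)
    (h0 : f 0 = 0) (hn : ∀ i, f i ≤ n) (hk : f k = n) (j : ℕ) :
    j ∈ (List.Ico 2 (k + 1)).reverse.foldl (fun M i => M ++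
      ((List.range n).reverse.filter fun j => j < e (i - 1) ∧ j ∉ M).take
        (min (f i) (e (i - 1)) - f (i - 1))) [] ↔
    ∃ i, 2 ≤ i ∧ i ≤ k ∧ f (i - 1) ≤ j ∧ j < min (f i) (e (i - 1)) := by
  -- Rounds run downwards from `k`; `d` counts those already done and `t` is the last of them.
  have key : ∀ d t : ℕ, 1 ≤ t → t + d = k + 1 → ∀ j,
      j ∈ (List.Ico t (k + 1)).reverse.foldl (fun M i => M ++
        ((List.range n).reverse.filter fun j => j < e (i - 1) ∧ j ∉ M).take
          (min (f i) (e (i - 1)) - f (i - 1))) [] ↔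
      ∃ i, t ≤ i ∧ i ≤ k ∧ f (i - 1) ≤ j ∧ j < min (f i) (e (i - 1)) := by
    intro d
    induction d with
    | zero =>
      intro t _ ht j
      obtain rfl : t = k + 1 := by omega
      simp
      omega
    | succ d ih =>
      intro t ht1 ht j
      rw [List.Ico.eq_cons (by omega), List.reverse_cons, List.foldl_append]
      have ih := ih (t + 1) (by omega) (by omega)
      generalize (List.Ico (t + 1) (k + 1)).reverse.foldl _ [] = M at ih
      have hfil : ((List.range n).reverse.filter fun j => j < e (t - 1) ∧ j ∉ M) =
          (List.range n).reverse.filter fun j => j < min (f t) (e (t - 1)) := by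
        refine List.filter_congr fun j hj => ?_
        have hjn : j < n := by simpa using hj
        rw [decide_eq_decide, ih, lt_min_iff, and_comm]
        refine and_congr_left fun hj => ⟨fun hM => ?_, fun hj' => ?_⟩
        · by_contra hc
          obtain ⟨l, h1, h2, h3, h4⟩ := exists_step_of_lt (by omega : f 0 ≤ j) (hk ▸ hjn : j < f k)
          have htl : t + 1 ≤ l := by
            by_contra hlt
            have := hf (show l ≤ t by omega)
            omega
          have := he (show t - 1 ≤ l - 1 by omega)
          exact hM ⟨l, htl, h2, h3, by omega⟩
        · rintro ⟨l, h1, h2, h3, h4⟩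
          have := hf (show t ≤ l - 1 by omega)
          omega
      simp only [List.foldl_cons, List.foldl_nil]
      have := hn t
      rw [List.mem_append, hfil, mem_take_filter_reverse_range_lt (by omega), ih]
      constructor
      · rintro (⟨i, h1, h2, h3⟩ | ⟨h1, h2⟩)
        · exact ⟨i, by omega, h2, h3⟩
        · exact ⟨t, le_rfl, by omega, by omega, h2⟩
      · rintro ⟨i, h1, h2, h3, h4⟩
        by_cases hik : i = t
        · subst hik
          exact Or.inr ⟨by omega, h4⟩
        · exact Or.inl ⟨i, by omega, h2, h3, h4⟩
  rcases Nat.eq_zero_or_pos k with rfl | hk'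
  · rw [List.Ico.eq_nil_of_le (by omega)]
    simp
  · exact key (k - 1) 2 (by omega) (by omega) j


/-! ### Blocks and positions -/

theorem ceilDiv_eq_div_or {n k : ℕ} (hk : 1 ≤ k) :
    n ⌈/⌉ k = n / k + if n % k = 0 then 0 else 1 := by
  rw [Nat.ceilDiv_eq_add_pred_div]
  have h1 := Nat.div_add_mod n k
  have h2 := Nat.mod_lt n hk
  split_ifs with h
  · have : n + k - 1 = (k - 1) + k * (n / k) := by omega
    rw [this, Nat.add_mul_div_left _ _ hk, Nat.div_eq_of_lt (by omega)]
    omega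
  · have : n + k - 1 = (n % k - 1) + k * (n / k + 1) := by rw [Nat.mul_add]; omega
    rw [this, Nat.add_mul_div_left _ _ hk, Nat.div_eq_of_lt (by omega)]
    omega

theorem blockEnd_eq {n k : ℕ} (hk : 1 ≤ k) (i : ℕ) :
    blockEnd n k i = i * (n / k) + min i (n % k) := by
  unfold blockEnd
  rw [ceilDiv_eq_div_or hk]
  by_cases h : n % k = 0
  · simp only [h, if_true]
    split_ifs with hi
    · obtain rfl : i = 0 := by omega
      simp
    · simp
  · simp only [h, if_false]
    split_ifs with hi
    · rw [min_eq_left hi]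
      ring
    · obtain ⟨d, rfl⟩ := Nat.exists_eq_add_of_le (not_le.1 hi).le
      rw [min_eq_right (by omega), Nat.add_sub_cancel_left]
      ring

theorem blockEnd_mono {n k : ℕ} (hk : 1 ≤ k) : Monotone (blockEnd n k) := by
  intro i j hij
  rw [blockEnd_eq hk, blockEnd_eq hk]
  have := Nat.mul_le_mul_right (n / k) hij
  omega

theorem blockEnd_zero (n k : ℕ) : blockEnd n k 0 = 0 := by simp [blockEnd]

theorem blockEnd_last {n k : ℕ} (hk : 1 ≤ k) : blockEnd n k k = n := by
  rw [blockEnd_eq hk, min_eq_right (Nat.mod_lt n hk).le, Nat.div_add_mod]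

theorem blockEnd_lt_succ {n k : ℕ} (hk : 1 ≤ k) (hkn : k ≤ n) (i : ℕ) :
    blockEnd n k i < blockEnd n k (i + 1) := by
  rw [blockEnd_eq hk, blockEnd_eq hk, Nat.add_one_mul]
  have := Nat.div_pos hkn hk
  omega

theorem blockEnd_sub_le {n k : ℕ} (hk : 1 ≤ k) (i : ℕ) :
    blockEnd n k i - blockEnd n k (i - 1) ≤ n ⌈/⌉ k := by
  cases i with
  | zero => simp
  | succ i =>
    rw [blockEnd_eq hk, blockEnd_eq hk, ceilDiv_eq_div_or hk, Nat.add_sub_cancel, Nat.add_one_mul]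
    generalize n / k = d
    generalize n % k = m
    split_ifs <;> omega

/-- The input of DIVIDE: servers in `[1, N - 1]` and integer requests `x 0, x 1, …`. -/
structure IsDivideInput (D : DivideSetup) (x : ℕ → ℝ) : Prop where
  sorted : D.servers.Pairwise (· ≤ ·)
  one_le : ∀ v ∈ D.servers, 1 ≤ v
  le_N : ∀ v ∈ D.servers, v + 1 ≤ D.N
  int : ∀ a, ∃ z : ℤ, x a = z
  one_le_k : 1 ≤ D.k
  k_le : D.k ≤ D.n

namespace DivideSetup

variable (D : DivideSetup)

/-- The position of the server with index `j`. -/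
def srv (j : ℕ) : ℝ := D.servers.getD j 0

variable {D} {x : ℕ → ℝ} (h : IsDivideInput D x)

include h

theorem srv_mono {i j : ℕ} (hij : i ≤ j) (hj : j < D.n) : D.srv i ≤ D.srv j := by
  have hj' : j < D.servers.length := hj
  unfold srv
  rw [List.getD_eq_getElem _ _ (by omega), List.getD_eq_getElem _ _ hj']
  rcases hij.lt_or_eq with hlt | rfl
  · exact List.pairwise_iff_getElem.1 h.sorted i j (by omega) hj' hlt
  · exact le_rfl

theorem one_le_srv {j : ℕ} (hj : j < D.n) : 1 ≤ D.srv j := by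
  have hj' : j < D.servers.length := hj
  unfold srv
  rw [List.getD_eq_getElem _ _ hj']
  exact h.one_le _ (List.getElem_mem _)

theorem srv_le {j : ℕ} (hj : j < D.n) : D.srv j + 1 ≤ D.N := by
  have hj' : j < D.servers.length := hj
  unfold srv
  rw [List.getD_eq_getElem _ _ hj']
  exact h.le_N _ (List.getElem_mem _)

theorem blockEnd_bounds {i : ℕ} (hi : 1 ≤ i) (hik : i < D.k) :
    1 ≤ blockEnd D.n D.k i ∧ blockEnd D.n D.k i < D.n := by
  have h1 := blockEnd_lt_succ h.one_le_k h.k_le (i - 1)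
  have h2 := blockEnd_lt_succ h.one_le_k h.k_le i
  have h3 := blockEnd_mono (n := D.n) h.one_le_k (show i + 1 ≤ D.k by omega)
  rw [blockEnd_last h.one_le_k] at h3
  rw [Nat.sub_add_cancel hi] at h1
  omega

theorem srv_le_p {i j : ℕ} (hi : 1 ≤ i) (hik : i < D.k) (hj : j < blockEnd D.n D.k i) :
    D.srv j ≤ D.p i := by
  obtain ⟨h1, h2⟩ := blockEnd_bounds h hi hik
  have h3 := srv_mono h (show j ≤ blockEnd D.n D.k i - 1 by omega) (by omega)
  have h4 := srv_mono h hj.le h2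
  change _ ≤ (D.srv _ + D.srv _) / 2
  linarith

theorem p_le_srv {i j : ℕ} (hi : 1 ≤ i) (hik : i < D.k) (hj : blockEnd D.n D.k i ≤ j)
    (hjn : j < D.n) : D.p i ≤ D.srv j := by
  obtain ⟨h1, h2⟩ := blockEnd_bounds h hi hik
  have h3 := srv_mono h (show blockEnd D.n D.k i - 1 ≤ j by omega) hjn
  have h4 := srv_mono h hj hjn
  change (D.srv _ + D.srv _) / 2 ≤ _
  linarith

theorem p_mono {i j : ℕ} (hi : 1 ≤ i) (hij : i ≤ j) (hj : j < D.k) : D.p i ≤ D.p j := by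
  have h1 := blockEnd_bounds h hi (by omega)
  have h2 := blockEnd_bounds h (by omega) hj
  have h3 := blockEnd_mono (n := D.n) h.one_le_k hij
  have h4 := srv_mono h (show blockEnd D.n D.k i - 1 ≤ blockEnd D.n D.k j - 1 by omega) (by omega)
  have h5 := srv_mono h h3 h2.2
  change (D.srv _ + D.srv _) / 2 ≤ (D.srv _ + D.srv _) / 2
  linarith

theorem one_le_p {i : ℕ} (hi : 1 ≤ i) (hik : i < D.k) : 1 ≤ D.p i := by
  have h1 := blockEnd_bounds h hi hik
  exact (one_le_srv h (j := 0) (by omega)).trans (srv_le_p h hi hik (by omega))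

theorem p_le {i : ℕ} (hi : 1 ≤ i) (hik : i < D.k) : D.p i + 1 ≤ D.N := by
  have h1 := blockEnd_bounds h hi hik
  have h2 := srv_le h h1.2
  have h3 := p_le_srv h hi hik le_rfl h1.2
  linarith

omit h in
theorem block_eq_card (y : ℝ) :
    D.block y = 1 + ((Finset.Ico 1 D.k).filter fun i => D.p i < y).card := rfl

omit h in
theorem one_le_block (y : ℝ) : 1 ≤ D.block y := by
  rw [block_eq_card]; omega

theorem block_le (y : ℝ) : D.block y ≤ D.k := by
  rw [block_eq_card]
  have := Finset.card_filter_le (Finset.Ico 1 D.k) fun i => D.p i < y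
  rw [Nat.card_Ico] at this
  have := h.one_le_k
  omega

omit h in
theorem block_mono {y z : ℝ} (hyz : y ≤ z) : D.block y ≤ D.block z := by
  rw [block_eq_card, block_eq_card]
  have := Finset.card_le_card (Finset.monotone_filter_right (Finset.Ico 1 D.k)
    (fun i _ (hi : D.p i < y) => (hi.trans_le hyz : D.p i < z)))
  omega

/-- The division points increase, so those below `y` form an initial segment and counting them
locates `y`. -/
theorem lt_block_iff {i : ℕ} (hi : 1 ≤ i) (hik : i < D.k) (y : ℝ) : i < D.block y ↔ D.p i < y := by
  rw [block_eq_card]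
  constructor
  · intro hlt
    by_contra hc
    have := Finset.card_le_card (show (Finset.Ico 1 D.k).filter (fun i => D.p i < y) ⊆
      Finset.Ico 1 i from fun j hj => by
        simp only [Finset.mem_filter, Finset.mem_Ico] at hj ⊢
        refine ⟨hj.1.1, ?_⟩
        by_contra hij
        exact hc ((p_mono h hi (not_lt.1 hij) hj.1.2).trans_lt hj.2))
    rw [Nat.card_Ico] at this
    omega
  · intro hlt
    have := Finset.card_le_card (show Finset.Ico 1 (i + 1) ⊆
      (Finset.Ico 1 D.k).filter (fun i => D.p i < y) from fun j hj => by
        simp only [Finset.mem_filter, Finset.mem_Ico] at hj ⊢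
        exact ⟨⟨hj.1, by omega⟩, (p_mono h hj.1 (by omega) hik).trans_lt hlt⟩)
    rw [Nat.card_Ico] at this
    omega

theorem block_of_le_zero {y : ℝ} (hy : y ≤ 0) : D.block y = 1 := by
  rw [block_eq_card, Finset.filter_false_of_mem, Finset.card_empty]
  intro i hi
  rw [Finset.mem_Ico] at hi
  have := one_le_p h hi.1 hi.2
  linarith

theorem block_of_N_le {y : ℝ} (hy : D.N ≤ y) : D.block y = D.k := by
  rw [block_eq_card, Finset.filter_true_of_mem, Nat.card_Ico]
  · have := h.one_le_k
    omega
  intro i hi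
  rw [Finset.mem_Ico] at hi
  have := p_le h hi.1 hi.2
  linarith

omit h in
theorem pos_mono {y z : ℝ} (hyz : y ≤ z) : D.pos y ≤ D.pos z :=
  Nat.floor_mono (min_le_min_right _ hyz)

/-- The cut-off is strictly increasing on the integers from 0 to `N`. So it can identify or reverse
two requests only where it is constant, beyond one of the two ends. -/
theorem outside_of_pos_le {a b : ℕ} (hP : D.pos (x b) ≤ D.pos (x a)) (hlt : x a < x b) :
    (x a ≤ 0 ∧ x b ≤ 0) ∨ ((D.N : ℝ) ≤ x a ∧ (D.N : ℝ) ≤ x b) := by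
  obtain ⟨u, hu⟩ := h.int a
  obtain ⟨v, hv⟩ := h.int b
  rw [hu, hv] at hlt hP ⊢
  have hlt' : u + 1 ≤ v := by exact_mod_cast hlt
  by_contra hc
  push Not at hc
  have hv0 : 0 < v := by
    by_contra h0
    have : (v : ℝ) ≤ 0 := by exact_mod_cast not_lt.1 h0
    exact absurd (hc.1 (by linarith)) (by linarith)
  have huN : (u : ℤ) < D.N := by
    by_contra h0
    have : (D.N : ℝ) ≤ u := by exact_mod_cast not_lt.1 h0
    exact absurd (hc.2 this) (by linarith)
  have hN : 1 ≤ D.N := by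
    have hn : 0 < D.n := h.one_le_k.trans h.k_le
    have h1 := one_le_srv h hn
    have h2 := srv_le h hn
    have : (1 : ℝ) ≤ D.N := by linarith
    exact_mod_cast this
  have e1 : (u : ℝ) ≤ u.toNat := by exact_mod_cast Int.self_le_toNat u
  have h1 : D.pos (u : ℝ) ≤ u.toNat := by
    unfold pos
    exact Nat.floor_le_of_le ((min_le_left _ _).trans e1)
  have h2 : u.toNat + 1 ≤ D.pos (v : ℝ) := by
    unfold pos
    refine Nat.le_floor (le_min ?_ ?_)
    · have : ((u.toNat + 1 : ℕ) : ℤ) ≤ v := by omega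
      exact_mod_cast this
    · have : u.toNat + 1 ≤ D.N := by omega
      exact_mod_cast this
  omega

theorem block_le_of_pos_le {a b : ℕ} (hP : D.pos (x a) ≤ D.pos (x b)) :
    D.block (x a) ≤ D.block (x b) := by
  rcases le_or_gt (x a) (x b) with hle | hlt
  · exact block_mono hle
  · rcases outside_of_pos_le h hP hlt with ⟨h1, h2⟩ | ⟨h1, h2⟩
    · rw [block_of_le_zero h h1, block_of_le_zero h h2]
    · rw [block_of_N_le h h1, block_of_N_le h h2]

theorem isBlockSystem : IsBlockSystem D.n D.k (fun a => D.pos (x a)) (fun a => D.block (x a))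
    (blockEnd D.n D.k) where
  e_mono := blockEnd_mono h.one_le_k
  e_zero := blockEnd_zero _ _
  e_last := blockEnd_last h.one_le_k
  one_le_block _ _ := one_le_block _
  block_le _ _ := block_le h _
  block_mono _ _ _ _ hP := block_le_of_pos_le h hP

end DivideSetup

/-! ### The monotone matching -/

namespace DivideSetup

variable (D : DivideSetup) (x : ℕ → ℝ)

/-- The server of request `a` in the monotone matching. -/
def optServer (a : ℕ) : ℕ :=
  monoRank D.n (fun a => D.pos (x a)) (fun a => D.block (x a)) (blockEnd D.n D.k) a

/-- The mark of request `a` according to the monotone matching. -/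
def optMark (a : ℕ) : Mark :=
  rankMark D.n (fun a => D.pos (x a)) (fun a => D.block (x a)) (blockEnd D.n D.k) a

variable {D x}

theorem optServer_lt {a : ℕ} (ha : a < D.n) : D.optServer x a < D.n := rank_lt _ _ _ ha

variable (h : IsDivideInput D x)

include h

/-- The division point at the right end of the block separates the request from the servers of all
later blocks. -/
theorem le_srv_optServer {a : ℕ} (ha : a < D.n) (hm : D.optMark x a = .right) :
    x a ≤ D.srv (D.optServer x a) ∧ D.block (x a) < D.k := by
  have hs := isBlockSystem h
  have h1 := (hs.rankMark_eq_right ha).1 hm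
  have h2 : D.optServer x a < D.n := optServer_lt ha
  have hk : D.block (x a) < D.k := by
    by_contra hc
    have := blockEnd_mono (n := D.n) h.one_le_k (not_lt.1 hc)
    rw [blockEnd_last h.one_le_k] at this
    exact absurd (this.trans h1) (not_le.2 h2)
  refine ⟨?_, hk⟩
  have h3 := (lt_block_iff h (one_le_block (x a)) hk (x a)).not.1 (lt_irrefl _)
  exact (not_lt.1 h3).trans (p_le_srv h (one_le_block _) hk h1 h2)

/-- The inequality is strict since blocks are open on the left. The asymmetry is used in `LRPlan`,
where a left request must not be at its server. -/
theorem srv_optServer_lt {a : ℕ} (ha : a < D.n) (hm : D.optMark x a = .left) :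
    D.srv (D.optServer x a) < x a ∧ 1 < D.block (x a) := by
  have hs := isBlockSystem h
  have h1 := (hs.rankMark_eq_left ha).1 hm
  have hk : 1 < D.block (x a) := by
    by_contra hc
    have : D.block (x a) - 1 = 0 := by omega
    rw [this, blockEnd_zero] at h1
    omega
  refine ⟨?_, hk⟩
  have hle := block_le h (x a)
  have h3 := (lt_block_iff h (i := D.block (x a) - 1) (by omega) (by omega) (x a)).1 (by omega)
  exact (srv_le_p h (by omega) (by omega) h1).trans_lt h3

/-- Cut-off positions cause no confusion: at 0 the block is the first one, which sends nothing to
the left, and at `N` it is the last one, which sends nothing to the right. -/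
theorem eq_of_pos_eq {a b : ℕ} (ha : a < D.n) (hb : b < D.n) (hP : D.pos (x a) = D.pos (x b))
    (hma : D.optMark x a = .right) (hmb : D.optMark x b = .left) : x a = x b := by
  have h1 := (le_srv_optServer h ha hma).2
  have h2 := (srv_optServer_lt h hb hmb).2
  have hB := (isBlockSystem h).block_eq ha hb hP
  rcases lt_trichotomy (x a) (x b) with hlt | he | hlt
  · rcases outside_of_pos_le h hP.ge hlt with ⟨_, h4⟩ | ⟨h3, _⟩
    · rw [block_of_le_zero h h4] at h2; omega
    · rw [block_of_N_le h h3] at h1; omega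
  · exact he
  · rcases outside_of_pos_le h hP.le hlt with ⟨h4, _⟩ | ⟨_, h3⟩
    · rw [block_of_le_zero h h4] at h2; omega
    · rw [block_of_N_le h h3] at h1; omega

omit h in
theorem abs_four_point {a b s t : ℝ} (hab : a ≤ b) (hst : s ≤ t) :
    |a - s| + |b - t| ≤ |a - t| + |b - s| := by
  rcases abs_cases (a - s) with h1 | h1 <;> rcases abs_cases (b - t) with h2 | h2 <;>
    rcases abs_cases (a - t) with h3 | h3 <;> rcases abs_cases (b - s) with h4 | h4 <;> linarith

/-- The monotone matching is optimal. -/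
theorem sum_optServer_le (m : ℕ → ℕ) (hm : Set.MapsTo m (Finset.range D.n) (Finset.range D.n))
    (hinj : Set.InjOn m (Finset.range D.n)) :
    ∑ a ∈ Finset.range D.n, |x a - D.srv (D.optServer x a)| ≤
      ∑ a ∈ Finset.range D.n, |x a - D.srv (m a)| := by
  have hs := isBlockSystem h
  have hex : ∀ i, ∃ a, i < D.n → a < D.n ∧ D.optServer x a = i := fun i => by
    by_cases hi : i < D.n
    · obtain ⟨a, h1, h2⟩ := hs.exists_rank_eq hi
      exact ⟨a, fun _ => ⟨h1, h2⟩⟩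
    · exact ⟨0, fun hc => absurd hc hi⟩
  -- `ρ` inverts the monotone matching: it lists the requests in the order of their servers.
  choose ρ hρ using hex
  have hlt : ∀ a < D.n, D.optServer x a < D.n := fun a ha => optServer_lt ha
  have hinv : ∀ a < D.n, ρ (D.optServer x a) = a := fun a ha => by
    have := hρ _ (hlt a ha)
    exact hs.rank_injOn (by simpa using this.1) (by simpa using ha) this.2
  have hsum : ∀ g : ℕ → ℝ, ∑ a ∈ Finset.range D.n, g (D.optServer x a) =
      ∑ i ∈ Finset.range D.n, g i := fun g =>
    Finset.sum_nbij (D.optServer x) (fun a ha => by simpa using hlt a (by simpa using ha))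
      hs.rank_injOn (fun i hi => by
        have := hρ i (by simpa using hi)
        exact ⟨ρ i, by simpa using this.1, this.2⟩) fun _ _ => rfl
  -- The Monge inequality is the four-point inequality if the requests are in order. If cutting off
  -- has reversed them, both are on one side of all servers and the two sides are equal.
  have key := sum_diag_le_sum_perm_of_monge (fun i j => |x (ρ i) - D.srv j|) (Finset.range D.n)
    (by
      intro i hi i' hi' j hj j' hj' hii hjj
      rw [Finset.mem_range] at hi hi' hj hj'
      have hS := srv_mono h hjj.le hj'
      have hP := pos_le_of_rank_lt (fun a => D.pos (x a)) (fun a => D.block (x a))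
        (blockEnd D.n D.k) (hρ i hi).1 (hρ i' hi').1
        (by
          change D.optServer x _ < D.optServer x _
          rw [(hρ i hi).2, (hρ i' hi').2]; exact hii)
      rcases le_or_gt (x (ρ i)) (x (ρ i')) with hle | hlt
      · exact abs_four_point hle hS
      · have b1 := one_le_srv h hj
        have b2 := srv_le h hj'
        rcases outside_of_pos_le h hP hlt with ⟨h1, h2⟩ | ⟨h1, h2⟩
        · rw [abs_of_nonpos (by linarith), abs_of_nonpos (by linarith), abs_of_nonpos (by linarith),
            abs_of_nonpos (by linarith)]
          linarith
        · rw [abs_of_nonneg (by linarith), abs_of_nonneg (by linarith), abs_of_nonneg (by linarith),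
            abs_of_nonneg (by linarith)]
          linarith)
    (fun i => m (ρ i))
    (fun i hi => hm (by simpa using (hρ i (by simpa using hi)).1))
    (fun i hi j hj hij => by
      have hi' := hρ i (by simpa using hi)
      have hj' := hρ j (by simpa using hj)
      have := hinj (by simpa using hi'.1) (by simpa using hj'.1) hij
      rw [← hi'.2, ← hj'.2, this])
  rw [← hsum fun i => |x (ρ i) - D.srv i|, ← hsum fun i => |x (ρ i) - D.srv (m (ρ i))|] at key
  refine le_trans (le_of_eq ?_) (key.trans (le_of_eq ?_))
  · refine Finset.sum_congr rfl fun a ha => ?_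
    rw [hinv a (by simpa using ha)]
  · refine Finset.sum_congr rfl fun a ha => ?_
    rw [hinv a (by simpa using ha)]

end DivideSetup

/-! ### The advice -/

namespace DivideSetup

variable (D : DivideSetup) (x : ℕ → ℝ)

/-- The mark that DIVIDE gives to request `a`. -/
def markAt (a : ℕ) : Mark := D.mark ((List.range a).map x) (x a)

/-- The advice in `D` describes the monotone matching for the requests `x 0, …, x (n - 1)`. -/
structure IsAdvised : Prop extends IsDivideInput D x where
  markAt_eq : ∀ a < D.n, D.markAt x a = D.optMark x a
  mem_markedR : ∀ a < D.n, D.optServer x a ∈ D.markedR ↔ D.optMark x a = .right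
  mem_markedL : ∀ a < D.n, D.optServer x a ∈ D.markedL ↔ D.optMark x a = .left

/-- The words q and d are read off from the monotone matching, and the counts m are the lengths of
the intervals of ranks that leave each block. -/
theorem exists_isAdvised (s : List ℝ) (k N : ℕ) (x : ℕ → ℝ)
    (sorted : s.Pairwise (· ≤ ·)) (one_le : ∀ v ∈ s, 1 ≤ v) (le_N : ∀ v ∈ s, v + 1 ≤ (N : ℝ))
    (int : ∀ a, ∃ z : ℤ, x a = z) (one_le_k : 1 ≤ k) (k_le : k ≤ s.length) :
    ∃ (D : DivideSetup) (l : List Bool), D.servers = s ∧ D.k = k ∧ D.N = N ∧ IsAdvised D x ∧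
      l.length ≤ (k - 1) * (2 * Nat.size N + 4 * Nat.size s.length) ∧
      AdviceProg.Reads (divideRead k N s) l D := by
  classical
  -- Positions and blocks do not depend on the advice, so they are taken from a setup with empty
  -- advice and agree definitionally with those of the final one.
  set D₀ : DivideSetup := ⟨s, k, N, fun _ => none, fun _ => none, fun _ => 0, fun _ => 0,
    fun _ => 0, fun _ => 0⟩
  have h₀ : IsDivideInput D₀ x := ⟨sorted, one_le, le_N, int, one_le_k, k_le⟩
  have hs := isBlockSystem h₀
  choose qR dR hR hR' hR'' using exists_adviceR D₀.n (fun a => D₀.pos (x a))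
    (fun a => D₀.block (x a)) (blockEnd D₀.n D₀.k)
  choose qL dL hL hL' hL'' using exists_adviceL D₀.n (fun a => D₀.pos (x a))
    (fun a => D₀.block (x a)) (blockEnd D₀.n D₀.k)
  set f := numUpTo D₀.n (fun a => D₀.block (x a))
  have hfm : Monotone f := numUpTo_mono _ _
  have hfn : ∀ i, f i ≤ D₀.n := numUpTo_le _ _
  have hf0 : f 0 = 0 := hs.numUpTo_zero
  have hfk : f D₀.k = D₀.n := hs.numUpTo_last
  set e := blockEnd D₀.n D₀.k
  have hem : Monotone e := hs.e_mono
  -- Block `i` has the ranks from `f (i - 1)` to `f i`; those from `e i` on leave to the right,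
  -- those below `e (i - 1)` to the left.
  set mR : ℕ → ℕ := fun i => f i - max (e i) (f (i - 1)) with hmR
  set mL : ℕ → ℕ := fun i => min (f i) (e (i - 1)) - f (i - 1) with hmL
  let D : DivideSetup := ⟨s, k, N, qL, qR, dL, mL, dR, mR⟩
  have h : IsDivideInput D x := ⟨sorted, one_le, le_N, int, one_le_k, k_le⟩
  have hrk : ∀ a, D.optServer x a = monoRank D₀.n (fun a => D₀.pos (x a))
    (fun a => D₀.block (x a)) e a := fun _ => rfl
  have hadv : IsAdvised D x := by
    refine ⟨h, ?_, ?_, ?_⟩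
    · intro a ha
      have key := hs.mark_eq_rankMark (qR := qR) (qL := qL) (dR := dR) (dL := dL) hR
        (fun b hb hb' => hR' _ b hb rfl hb') hL (fun b hb hb' => hL' _ b hb rfl hb') ha
      have hc : numEarlier (fun a => D₀.pos (x a)) a =
          (((List.range a).map x).filter fun z => D.pos z = D.pos (x a)).length := by
        rw [List.filter_map, List.length_map]
        rfl
      rw [hc] at key
      exact key
    · intro a ha
      refine (mem_foldl_markR hem hfm hf0 hfn _).trans ?_
      refine Iff.trans ?_ (hs.rankMark_eq_right ha).symm
      rw [hrk]
      constructor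
      · rintro ⟨i, h1, h2, h3, h4⟩
        have := hs.block_eq_of_rank ha ((le_max_right _ _).trans h3) h4
        rw [this]
        exact (le_max_left _ _).trans h3
      · intro h1
        refine ⟨_, hs.one_le_block a ha, ?_, max_le h1 (hs.numUpTo_le_rank ha),
          hs.rank_lt_numUpTo ha⟩
        exact (le_srv_optServer h ha ((hs.rankMark_eq_right ha).2 h1)).2
    · intro a ha
      refine (mem_foldl_markL hem hfm hf0 hfn hfk _).trans ?_
      refine Iff.trans ?_ (hs.rankMark_eq_left ha).symm
      rw [hrk]
      constructor
      · rintro ⟨i, h1, h2, h3, h4⟩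
        have := hs.block_eq_of_rank ha h3 (h4.trans_le (min_le_left _ _))
        rw [this]
        exact h4.trans_le (min_le_right _ _)
      · intro h1
        refine ⟨_, ?_, hs.block_le a ha, hs.numUpTo_le_rank ha, lt_min (hs.rank_lt_numUpTo ha) h1⟩
        exact (srv_optServer_lt h ha ((hs.rankMark_eq_left ha).2 h1)).2
  have hcut : ∀ a, numNotLeft D₀.n (fun a => D₀.pos (x a)) (fun a => D₀.block (x a)) e a ≤ D₀.n :=
    fun a => (Nat.sub_le _ _).trans (numBelow_le _ _ _)
  have hcut' : ∀ a, numStay D₀.n (fun a => D₀.pos (x a)) (fun a => D₀.block (x a)) e a ≤ D₀.n :=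
    fun a => (Nat.sub_le _ _).trans (max_le (numBelow_le _ _ _)
      ((min_le_left _ _).trans (numBelow_le _ _ _)))
  obtain ⟨l, hl, hl'⟩ := exists_reads_divideRead D
    (by
      intro i q hq
      obtain ⟨a, ha, hB, hr, rfl, -⟩ := hL i q hq
      have h1 := (srv_optServer_lt h ha ((hs.rankMark_eq_left ha).2 (by rw [hB]; exact hr)))
      have h2 := one_le_srv h (optServer_lt (D := D) (x := x) ha)
      subst hB
      refine ⟨h1.2, hs.block_le a ha, ?_, ?_⟩
      · refine Nat.floor_pos.2 (le_min (by linarith) ?_)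
        have := srv_le h (optServer_lt (D := D) (x := x) ha)
        change (1 : ℝ) ≤ D.N
        linarith
      · refine Nat.floor_le_of_le ?_
        exact min_le_right _ _)
    (by
      intro i q hq
      obtain ⟨a, ha, hB, hr, rfl, -⟩ := hR i q hq
      have h1 := (le_srv_optServer h ha ((hs.rankMark_eq_right ha).2 (by rw [hB]; exact hr)))
      have h2 := srv_le h (optServer_lt (D := D) (x := x) ha)
      have h3 := one_le_srv h (optServer_lt (D := D) (x := x) ha)
      subst hB
      refine ⟨one_le_block _, h1.2, ?_⟩
      refine (Nat.floor_lt' ?_).2 ((min_le_left _ _).trans_lt (by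
        change x a < (D.N : ℝ)
        linarith))
      have : (0 : ℝ) < D.N := by linarith
      change D.N ≠ 0
      exact_mod_cast this.ne')
    (by
      intro i hi
      refine ⟨hL'' i hi, ?_⟩
      by_contra hc
      -- If the count were positive, the request of rank `f (i - 1)` would belong to block `i` and
      -- leave to the left, so `qL i` would not be `none`.
      have hc' : f (i - 1) < min (f i) (e (i - 1)) := by
        have : mL i ≠ 0 := hc
        simp only [hmL] at this
        omega
      have hn' := hfn i
      obtain ⟨a, ha, hr⟩ := hs.exists_rank_eq (j := f (i - 1))
        (hc'.trans_le ((min_le_left _ _).trans hn'))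
      have hB := hs.block_eq_of_rank (i := i) ha hr.ge (hr.trans_lt (hc'.trans_le (min_le_left _ _)))
      obtain ⟨y, hy, -⟩ := hL' i a ha hB (hr.trans_lt (hc'.trans_le (min_le_right _ _)))
      have : qL i = none := hi
      rw [this] at hy
      cases hy)
    (by
      intro i hi
      refine ⟨hR'' i hi, ?_⟩
      by_contra hc
      have hc' : max (e i) (f (i - 1)) < f i := by
        have : mR i ≠ 0 := hc
        simp only [hmR] at this
        omega
      have hn' := hfn i
      obtain ⟨a, ha, hr⟩ := hs.exists_rank_eq (j := max (e i) (f (i - 1))) (hc'.trans_le hn')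
      have hB := hs.block_eq_of_rank (i := i) ha (hr ▸ le_max_right _ _) (hr.trans_lt hc')
      obtain ⟨y, hy, -⟩ := hR' i a ha hB (hr ▸ le_max_left _ _)
      have : qR i = none := hi
      rw [this] at hy
      cases hy)
    (by
      intro i
      change dL i ≤ D₀.n
      cases hq : qL i with
      | none => rw [hL'' i hq]; omega
      | some q =>
        obtain ⟨a, -, -, -, -, hd⟩ := hL i q hq
        rw [hd]; exact hcut a)
    (fun i => (Nat.sub_le _ _).trans ((min_le_left _ _).trans (hfn i)))
    (by
      intro i
      change dR i ≤ D₀.n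
      cases hq : qR i with
      | none => rw [hR'' i hq]; omega
      | some q =>
        obtain ⟨a, -, -, -, -, hd⟩ := hR i q hq
        rw [hd]; exact hcut' a)
    (fun i => (Nat.sub_le _ _).trans (hfn i))
  exact ⟨D, l, rfl, rfl, rfl, hadv, hl, hl'⟩

end DivideSetup


/-! ### Costs of matchings -/

theorem matchingCost_nonneg (s r : List ℝ) (m : List ℕ) : 0 ≤ matchingCost s r m := by
  unfold matchingCost
  induction r generalizing m with
  | nil => simp
  | cons x r ih =>
    cases m with
    | nil => simp
    | cons j m => simpa using add_nonneg (abs_nonneg (x - s.getD j 0)) (ih m)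

theorem optCost_nonneg (s r : List ℝ) : 0 ≤ optCost s r := by
  refine Real.sInf_nonneg ?_
  rintro _ ⟨m, -, rfl⟩
  exact matchingCost_nonneg s r m

theorem optCost_le {s : List ℝ} (r : List ℝ) {m : List ℕ} (hm : IsMatching s m) :
    optCost s r ≤ matchingCost s r m :=
  csInf_le ⟨0, by rintro _ ⟨m, -, rfl⟩; exact matchingCost_nonneg s r m⟩ ⟨m, hm, rfl⟩

theorem le_optCost {s r : List ℝ} {v : ℝ} (h : ∀ m, IsMatching s m → v ≤ matchingCost s r m) :
    v ≤ optCost s r := by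
  refine le_csInf ⟨_, List.range s.length, List.Perm.refl _, rfl⟩ ?_
  rintro _ ⟨m, hm, rfl⟩
  exact h m hm

theorem matchingCost_map {α : Type*} (s : List ℝ) (L : List α) (x : α → ℝ) (f : α → ℕ) :
    matchingCost s (L.map x) (L.map f) = (L.map fun b => |x b - s.getD (f b) 0|).sum := by
  simp [matchingCost]

theorem sum_filter_range_eq (n : ℕ) (p : ℕ → Prop) [DecidablePred p] (g : ℕ → ℝ) :
    (((List.range n).filter fun b => p b).map g).sum =
      ∑ b ∈ (Finset.range n).filter p, g b := by
  rw [← List.sum_toFinset _ (List.nodup_range.filter _), List.toFinset_filter, List.toFinset_range]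
  simp

theorem sum_map_range_eq (n : ℕ) (g : ℕ → ℝ) :
    ((List.range n).map g).sum = ∑ b ∈ Finset.range n, g b := by
  rw [← List.sum_toFinset _ List.nodup_range, List.toFinset_range]

theorem map_idxOf_self {l : List ℕ} (hl : l.Nodup) : l.map (fun j => l.idxOf j) = List.range l.length := by
  refine List.ext_getElem (by simp) fun i h1 h2 => ?_
  simp only [List.length_map] at h1
  simp [hl.idxOf_getElem i h1]

/-! ### The subroutine on a block -/

/-- The subroutine sees only a subsequence of the requests; its history at `b` consists of the
earlier members. The starting point `a` is free for the induction. -/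
theorem serve_filter (A : OnlineAlg) (s : List ℝ) (x : ℕ → ℝ) (p : ℕ → Prop)
    [DecidablePred p] (a m : ℕ) :
    A.serve s (((List.range a).filter fun b => p b).map x)
      (((List.range' a m).filter fun b => p b).map x) =
    ((List.range' a m).filter fun b => p b).map
      (fun b => A s (((List.range b).filter fun b => p b).map x) (x b)) := by
  induction m generalizing a with
  | zero => simp [OnlineAlg.serve]
  | succ m ih =>
    have ih := ih (a + 1)
    rw [List.range_succ, List.filter_append] at ih
    rw [List.range'_succ, List.filter_cons]
    by_cases ha : p a
    · simp only [ha, decide_true, if_true, List.map_cons, OnlineAlg.serve, List.cons.injEq,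
        true_and]
      rw [← ih]
      simp [ha]
    · simp only [ha, decide_false, Bool.false_eq_true, if_false]
      rw [← ih]
      simp [ha]

/-! ### The run of DIVIDE, request by request -/

namespace DivideSetup

variable (D : DivideSetup) (x : ℕ → ℝ)

open Classical in
/-- The unmarked requests of block `i` among the first `a`. -/
def stayList (i a : ℕ) : List ℕ :=
  (List.range a).filter fun b => D.markAt x b = .unmarked ∧ D.block (x b) = i

/-- The state of LR after `a` requests. -/
def lrState : ℕ → List (ℕ × ℝ)
  | 0 => lrInit (D.positions D.markedServers)
  | a + 1 =>
    match D.markAt x a with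
    | .unmarked => lrState a
    | .right => ((lrStep (lrState a) (x a)).run fun _ => true).1.2
    | .left => ((lrStep (lrState a) (x a)).run fun _ => false).1.2

/-- The answer of LR to the marked request `a`. -/
def lrAnswer (a : ℕ) : ℕ :=
  match D.markAt x a with
  | .unmarked => 0
  | .right => ((lrStep (D.lrState x a) (x a)).run fun _ => true).1.1
  | .left => ((lrStep (D.lrState x a) (x a)).run fun _ => false).1.1

/-- The answer of `A` to the unmarked request `a`. -/
def subAnswer (A : OnlineAlg) (a : ℕ) : ℕ :=
  A (D.positions (D.unmarkedServers (D.block (x a)))) ((D.stayList x (D.block (x a)) a).map x) (x a)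

/-- The answer of DIVIDE to the request `a`. -/
def answer (A : OnlineAlg) (a : ℕ) : ℕ :=
  match D.markAt x a with
  | .unmarked => (D.unmarkedServers (D.block (x a))).getD (D.subAnswer x A a) 0
  | .right => D.markedServers.getD (D.lrAnswer x a) 0
  | .left => D.markedServers.getD (D.lrAnswer x a) 0

/-- The state of DIVIDE after `a` requests. -/
def stateAt (a : ℕ) : DivideState :=
  ⟨D, (List.range a).map x, fun i => (D.stayList x i a).map x, D.lrState x a⟩

theorem divideStep_stateAt (A : OnlineAlg) (a : ℕ) :
    divideStep A (D.stateAt x a) (x a) = (D.answer x A a, D.stateAt x (a + 1)) := by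
  have hmark : (D.stateAt x a).setup.mark (D.stateAt x a).past (x a) = D.markAt x a := rfl
  unfold divideStep
  rw [hmark]
  cases hm : D.markAt x a with
  | unmarked =>
    refine Prod.ext ?_ ?_
    · simp only [answer, hm]
      rfl
    · simp only [divideUnmarkedStep, stateAt, DivideState.mk.injEq, lrState, hm, and_true, true_and]
      refine ⟨by rw [List.range_succ]; simp, ?_⟩
      funext i
      unfold stayList
      rw [List.range_succ, List.filter_append]
      by_cases hi : D.block (x a) = i
      · subst hi
        simp [hm]
      · rw [Function.update_of_ne (Ne.symm hi)]
        simp [hi]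
  | right =>
    refine Prod.ext ?_ ?_
    · simp only [answer, hm, lrAnswer]
      rfl
    · simp only [divideMarkedStep, stateAt, DivideState.mk.injEq, lrState, hm, and_true, true_and]
      refine ⟨by rw [List.range_succ]; simp, ?_⟩
      funext i
      unfold stayList
      rw [List.range_succ, List.filter_append]
      simp [hm]
  | left =>
    refine Prod.ext ?_ ?_
    · simp only [answer, hm, lrAnswer]
      rfl
    · simp only [divideMarkedStep, stateAt, DivideState.mk.injEq, lrState, hm, and_true, true_and]
      refine ⟨by rw [List.range_succ]; simp, ?_⟩
      funext i
      unfold stayList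
      rw [List.range_succ, List.filter_append]
      simp [hm]

theorem output_block (A : OnlineAlg) (i : ℕ) :
    A.output (D.positions (D.unmarkedServers i)) ((D.stayList x i D.n).map x) =
      (D.stayList x i D.n).map (D.subAnswer x A) := by
  classical
  have := serve_filter A (D.positions (D.unmarkedServers i)) x
    (fun b => D.markAt x b = .unmarked ∧ D.block (x b) = i) 0 D.n
  rw [← List.range_eq_range'] at this
  refine this.trans (List.map_congr_left fun b hb => ?_)
  simp only [List.mem_filter, decide_eq_true_eq] at hb
  unfold subAnswer stayList
  rw [hb.2.2]

variable {D x}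

theorem mem_stayList {i a b : ℕ} :
    b ∈ D.stayList x i a ↔ b < a ∧ D.markAt x b = .unmarked ∧ D.block (x b) = i := by
  simp [stayList]

theorem nodup_stayList (i a : ℕ) : (D.stayList x i a).Nodup := List.nodup_range.filter _

theorem nodup_markedServers : D.markedServers.Nodup := List.nodup_range.filter _

theorem nodup_unmarkedServers (i : ℕ) : (D.unmarkedServers i).Nodup := List.nodup_range.filter _

theorem getD_positions (l : List ℕ) {q : ℕ} (hq : q < l.length) :
    (D.positions l).getD q 0 = D.srv (l.getD q 0) := by
  simp [positions, srv, hq]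

theorem mem_unmarkedServers {i j : ℕ} : j ∈ D.unmarkedServers i ↔ j < D.n ∧
    blockEnd D.n D.k (i - 1) ≤ j ∧ j < blockEnd D.n D.k i ∧ j ∉ D.markedR ∧ j ∉ D.markedL := by
  simp [unmarkedServers]

theorem mem_markedServers {j : ℕ} :
    j ∈ D.markedServers ↔ j < D.n ∧ (j ∈ D.markedR ∨ j ∈ D.markedL) := by
  simp [markedServers]

/-! ### Perfect matching and cost under correct advice -/

namespace IsAdvised

variable (h : IsAdvised D x)

include h

theorem optServer_mem_marked {a : ℕ} (ha : a < D.n) :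
    D.optServer x a ∈ D.markedServers ↔ D.markAt x a ≠ .unmarked := by
  rw [mem_markedServers, h.mem_markedR a ha, h.mem_markedL a ha, h.markAt_eq a ha]
  have := optServer_lt (x := x) ha
  cases D.optMark x a <;> simp [this]

theorem optServer_mem_unmarked {a i : ℕ} (ha : a < D.n) :
    D.optServer x a ∈ D.unmarkedServers i ↔ D.markAt x a = .unmarked ∧ D.block (x a) = i := by
  have hs := isBlockSystem h.toIsDivideInput
  have hlt := optServer_lt (x := x) ha
  have hu := hs.rankMark_eq_unmarked ha
  change D.optMark x a = _ ↔ blockEnd D.n D.k (D.block (x a) - 1) ≤ D.optServer x a ∧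
    D.optServer x a < blockEnd D.n D.k (D.block (x a)) at hu
  rw [mem_unmarkedServers, h.mem_markedR a ha, h.mem_markedL a ha, h.markAt_eq a ha]
  constructor
  · rintro ⟨-, h1, h2, h3, h4⟩
    have hm : D.optMark x a = .unmarked := by
      cases hc : D.optMark x a <;> simp_all
    refine ⟨hm, ?_⟩
    obtain ⟨h5, h6⟩ := hu.1 hm
    rcases lt_trichotomy (D.block (x a)) i with hi | hi | hi
    · have := hs.e_mono (show D.block (x a) ≤ i - 1 by omega)
      omega
    · exact hi
    · have := hs.e_mono (show i ≤ D.block (x a) - 1 by omega)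
      omega
  · rintro ⟨hm, rfl⟩
    obtain ⟨h5, h6⟩ := hu.1 hm
    simp [hm, h5, h6, hlt]

theorem exists_optServer_eq {j : ℕ} (hj : j < D.n) : ∃ a < D.n, D.optServer x a = j :=
  (isBlockSystem h.toIsDivideInput).exists_rank_eq hj

theorem optServer_inj {a b : ℕ} (ha : a < D.n) (hb : b < D.n)
    (hab : D.optServer x a = D.optServer x b) : a = b :=
  (isBlockSystem h.toIsDivideInput).rank_injOn (by simpa using ha) (by simpa using hb) hab

/-- The monotone matching pairs the unmarked requests of a block with its unmarked servers. Hence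
each block is a balanced input, to which the competitiveness of the subroutine applies. -/
theorem map_optServer_perm (i : ℕ) :
    ((D.stayList x i D.n).map (D.optServer x)).Perm (D.unmarkedServers i) := by
  rw [List.perm_ext_iff_of_nodup _ (nodup_unmarkedServers i)]
  · intro j
    rw [List.mem_map]
    constructor
    · rintro ⟨a, ha, rfl⟩
      rw [mem_stayList] at ha
      exact (h.optServer_mem_unmarked ha.1).2 ha.2
    · intro hj
      obtain ⟨a, ha, rfl⟩ := h.exists_optServer_eq (mem_unmarkedServers.1 hj).1
      exact ⟨a, mem_stayList.2 ⟨ha, (h.optServer_mem_unmarked ha).1 hj⟩, rfl⟩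
  · exact (nodup_stayList i D.n).map_on fun a ha b hb hab =>
      h.optServer_inj (mem_stayList.1 ha).1 (mem_stayList.1 hb).1 hab

theorem sorted_positions {l : List ℕ} (hl : l.Sublist (List.range D.n)) :
    (D.positions l).Pairwise (· ≤ ·) := by
  refine List.pairwise_map.2 ?_
  refine (List.pairwise_lt_range.sublist hl).imp_of_mem fun {i j} hi hj hij => ?_
  exact srv_mono h.toIsDivideInput hij.le (by simpa using hl.subset hj)

theorem isInput_block (i : ℕ) :
    IsInput (D.positions (D.unmarkedServers i)) ((D.stayList x i D.n).map x) where
  sorted := h.sorted_positions List.filter_sublist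
  length_eq := by
    have := (h.map_optServer_perm i).length_eq
    simpa [positions] using this

theorem length_unmarkedServers_le (i : ℕ) :
    (D.positions (D.unmarkedServers i)).length ≤ D.n ⌈/⌉ D.k := by
  refine le_trans ?_ (blockEnd_sub_le (n := D.n) h.one_le_k i)
  rw [positions, List.length_map, ← List.toFinset_card_of_nodup (nodup_unmarkedServers i),
    ← Nat.card_Ico]
  refine Finset.card_le_card fun j hj => ?_
  rw [List.mem_toFinset, mem_unmarkedServers] at hj
  exact Finset.mem_Ico.2 ⟨hj.2.1, hj.2.2.1⟩

/-- The restriction of the monotone matching, with servers renumbered inside the block, is a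
competitor for the optimum of the block. -/
theorem optCost_block_le (i : ℕ) :
    optCost (D.positions (D.unmarkedServers i)) ((D.stayList x i D.n).map x) ≤
      ((D.stayList x i D.n).map fun b => |x b - D.srv (D.optServer x b)|).sum := by
  have hperm := h.map_optServer_perm i
  have hm : IsMatching (D.positions (D.unmarkedServers i)) ((D.stayList x i D.n).map
      fun b => (D.unmarkedServers i).idxOf (D.optServer x b)) := by
    have := hperm.map fun j => (D.unmarkedServers i).idxOf j
    rw [map_idxOf_self (nodup_unmarkedServers i), List.map_map] at this
    unfold IsMatching positions
    rw [List.length_map]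
    exact this
  refine (optCost_le _ hm).trans (le_of_eq ?_)
  rw [matchingCost_map]
  refine congrArg List.sum (List.map_congr_left fun b hb => ?_)
  have hmem : D.optServer x b ∈ D.unmarkedServers i := hperm.subset (List.mem_map_of_mem hb)
  have hlt := List.idxOf_lt_length_of_mem hmem
  rw [getD_positions _ hlt, List.getD_eq_getElem _ _ hlt, List.getElem_idxOf]

/-- LR serves the marked requests at most at their cost in the monotone matching. -/
theorem lr_le :
    (∀ b ∈ markedFrom (D.markAt x) D.n 0, D.lrAnswer x b < D.markedServers.length) ∧
    Set.InjOn (D.lrAnswer x) (markedFrom (D.markAt x) D.n 0) ∧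
    ∑ b ∈ markedFrom (D.markAt x) D.n 0, |x b - D.srv (D.markedServers.getD (D.lrAnswer x b) 0)| ≤
      ∑ b ∈ markedFrom (D.markAt x) D.n 0, |x b - D.srv (D.optServer x b)| := by
  set V : ℕ → ℝ := fun q => (D.positions D.markedServers).getD q 0 with hV
  have hin := h.toIsDivideInput
  have hmemb : ∀ b ∈ markedFrom (D.markAt x) D.n 0, b < D.n ∧ D.optServer x b ∈ D.markedServers :=
    fun b hb => by
      rw [mem_markedFrom] at hb
      exact ⟨hb.1.2, (h.optServer_mem_marked hb.1.2).2 hb.2⟩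
  have hidx : ∀ b ∈ markedFrom (D.markAt x) D.n 0,
      D.markedServers.idxOf (D.optServer x b) < D.markedServers.length := fun b hb =>
    List.idxOf_lt_length_of_mem (hmemb b hb).2
  have hget : ∀ b ∈ markedFrom (D.markAt x) D.n 0,
      D.markedServers.getD (D.markedServers.idxOf (D.optServer x b)) 0 = D.optServer x b :=
    fun b hb => by rw [List.getD_eq_getElem _ _ (hidx b hb), List.getElem_idxOf]
  have hVτ : ∀ b ∈ markedFrom (D.markAt x) D.n 0,
      V (D.markedServers.idxOf (D.optServer x b)) = D.srv (D.optServer x b) := fun b hb => by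
    rw [hV]
    simp only
    rw [getD_positions _ (hidx b hb), hget b hb]
  have hinit : ∀ p : ℕ × ℝ, p ∈ lrInit (D.positions D.markedServers) ↔
      p.1 < D.markedServers.length ∧ p.2 = V p.1 := by
    rintro ⟨q, v⟩
    have hlen : (D.positions D.markedServers).length = D.markedServers.length := by simp [positions]
    simp only [lrInit, List.mem_map, Prod.exists, Prod.swap_prod_mk, Prod.mk.injEq,
      List.mk_mem_zipIdx_iff_getElem?]
    constructor
    · rintro ⟨v', q', hq, rfl, rfl⟩
      obtain ⟨hlt, hv⟩ := List.getElem?_eq_some_iff.1 hq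
      refine ⟨hlen ▸ hlt, ?_⟩
      rw [hV]
      simp only
      rw [List.getD_eq_getElem _ _ hlt, hv]
    · rintro ⟨hlt, rfl⟩
      refine ⟨_, q, ?_, rfl, rfl⟩
      rw [hV]
      simp only
      rw [List.getD_eq_getElem _ _ (hlen ▸ hlt)]
      exact List.getElem?_eq_getElem _
  have hsorted : (lrInit (D.positions D.markedServers)).Pairwise (fun p q => p.2 ≤ q.2) := by
    have h1 : (lrInit (D.positions D.markedServers)).map Prod.snd = D.positions D.markedServers := by
      unfold lrInit
      rw [List.map_map]
      have : (Prod.snd ∘ Prod.swap : ℝ × ℕ → ℝ) = Prod.fst := by ext p; rfl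
      rw [this, List.zipIdx_map_fst]
    have h2 := h.sorted_positions (l := D.markedServers) List.filter_sublist
    rw [← h1] at h2
    exact List.pairwise_map.1 h2
  have hplan : LRPlan (D.markAt x) x V D.n 0 (D.lrState x 0)
      (fun b => D.markedServers.idxOf (D.optServer x b)) := by
    refine ⟨hsorted, fun p hp => ((hinit p).1 hp).2, fun b hb => (hinit _).2 ⟨hidx b hb, rfl⟩,
      ?_, ?_, ?_, ?_⟩
    · intro b hb c hc hbc
      have := (hget b hb).symm.trans ((congrArg (fun q => D.markedServers.getD q 0) hbc).trans
        (hget c hc))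
      exact h.optServer_inj (hmemb b hb).1 (hmemb c hc).1 this
    · intro b hb hm
      rw [hVτ b hb]
      have hbn := (hmemb b hb).1
      exact (le_srv_optServer hin hbn (h.markAt_eq b hbn ▸ hm)).1
    · intro b hb hm
      rw [hVτ b hb]
      have hbn := (hmemb b hb).1
      exact (srv_optServer_lt hin hbn (h.markAt_eq b hbn ▸ hm)).1
    · intro b hb c hc hmb hmc
      rw [hVτ b hb, hVτ c hc]
      have hbn := (hmemb b hb).1
      have hcn := (hmemb c hc).1
      -- If the server of `c` comes first, then the position of `c` is not beyond that of `b`; were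
      -- `c` still to the right of `b`, the positions would be equal, and `eq_of_pos_eq` would put
      -- both at one point.
      rcases lt_or_ge (D.optServer x c) (D.optServer x b) with hlt | hle
      · right
        have hP := pos_le_of_rank_lt _ _ _ hcn hbn hlt
        rcases lt_or_ge (x b) (x c) with hx | hx
        · have hP' : D.pos (x b) ≤ D.pos (x c) := pos_mono hx.le
          exact (eq_of_pos_eq hin hbn hcn (le_antisymm hP' hP) (h.markAt_eq b hbn ▸ hmb)
            (h.markAt_eq c hcn ▸ hmc)).ge
        · exact hx
      · exact Or.inl (srv_mono hin hle (optServer_lt hcn))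
  obtain ⟨h1, h2, h3⟩ := LRPlan.lr_le (M := D.markAt x) (x := x) (V := V) (n := D.n)
    (st := D.lrState x) (ch := D.lrAnswer x)
    (by
      intro b c hbc hc hmb hmc hx
      rw [h.markAt_eq b (hbc.trans hc)] at hmb
      rw [h.markAt_eq c hc] at hmc
      exact (isBlockSystem hin).not_left_before_right hbc hc (congrArg D.pos hx) hmb hmc)
    (by
      intro a _ hm
      simp only [lrState, hm])
    (by
      intro a _ hm
      cases hc : D.markAt x a with
      | unmarked => exact absurd hc hm
      | right => simp only [lrState, lrAnswer, hc, lrStep_run]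
      | left => simp only [lrState, lrAnswer, hc, lrStep_run])
    (by
      intro a _ hm
      simp only [lrAnswer, hm, lrStep_run])
    (by
      intro a _ hm
      simp only [lrAnswer, hm, lrStep_run])
    (Nat.zero_le _) hplan
  have hlt : ∀ b ∈ markedFrom (D.markAt x) D.n 0, D.lrAnswer x b < D.markedServers.length :=
    fun b hb => ((hinit _).1 (h1 b hb)).1
  refine ⟨hlt, h2, ?_⟩
  refine le_trans (le_of_eq ?_) (h3.trans (le_of_eq ?_))
  · refine Finset.sum_congr rfl fun b hb => ?_
    rw [hV]
    simp only
    rw [getD_positions _ (hlt b hb)]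
  · refine Finset.sum_congr rfl fun b hb => ?_
    rw [hVτ b hb]

omit h in
theorem answer_of_marked (A : OnlineAlg) {a : ℕ} (hm : D.markAt x a ≠ .unmarked) :
    D.answer x A a = D.markedServers.getD (D.lrAnswer x a) 0 := by
  cases hc : D.markAt x a with
  | unmarked => exact absurd hc hm
  | right => simp only [answer, hc]
  | left => simp only [answer, hc]

omit h in
theorem answer_of_unmarked (A : OnlineAlg) {a : ℕ} (hm : D.markAt x a = .unmarked) :
    D.answer x A a = (D.unmarkedServers (D.block (x a))).getD (D.subAnswer x A a) 0 := by
  simp only [answer, hm]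

theorem answer_mem_marked (A : OnlineAlg) {a : ℕ} (ha : a < D.n)
    (hm : D.markAt x a ≠ .unmarked) : D.answer x A a ∈ D.markedServers := by
  have := h.lr_le.1 a (mem_markedFrom.2 ⟨⟨Nat.zero_le _, ha⟩, hm⟩)
  rw [answer_of_marked A hm, List.getD_eq_getElem _ _ this]
  exact List.getElem_mem _

omit h in
theorem subAnswer_lt {A : OnlineAlg} (hA : ∀ i, IsMatching (D.positions (D.unmarkedServers i))
      (A.output (D.positions (D.unmarkedServers i)) ((D.stayList x i D.n).map x)))
    {a : ℕ} (ha : a < D.n) (hm : D.markAt x a = .unmarked) :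
    D.subAnswer x A a < (D.unmarkedServers (D.block (x a))).length := by
  have := hA (D.block (x a))
  rw [output_block, IsMatching] at this
  have := this.subset (List.mem_map_of_mem (mem_stayList.2 ⟨ha, hm, rfl⟩))
  simpa [positions] using this

omit h in
theorem answer_mem_unmarked {A : OnlineAlg} (hA : ∀ i, IsMatching (D.positions (D.unmarkedServers i))
      (A.output (D.positions (D.unmarkedServers i)) ((D.stayList x i D.n).map x)))
    {a : ℕ} (ha : a < D.n) (hm : D.markAt x a = .unmarked) :
    D.answer x A a ∈ D.unmarkedServers (D.block (x a)) := by
  rw [answer_of_unmarked A hm, List.getD_eq_getElem _ _ (subAnswer_lt hA ha hm)]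
  exact List.getElem_mem _

omit h in
theorem block_eq_of_mem_unmarked (h : IsAdvised D x) {i i' j : ℕ} (hi : j ∈ D.unmarkedServers i)
    (hi' : j ∈ D.unmarkedServers i') : i = i' := by
  obtain ⟨a, ha, rfl⟩ := h.exists_optServer_eq (mem_unmarkedServers.1 hi).1
  exact ((h.optServer_mem_unmarked ha).1 hi).2.symm.trans ((h.optServer_mem_unmarked ha).1 hi').2

omit h in
theorem notMem_marked_of_mem_unmarked {i j : ℕ} (hi : j ∈ D.unmarkedServers i) :
    j ∉ D.markedServers := by
  rw [mem_unmarkedServers] at hi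
  rw [mem_markedServers]
  tauto

omit h in
theorem getD_inj {l : List ℕ} (hl : l.Nodup) {i j : ℕ} (hi : i < l.length) (hj : j < l.length)
    (hij : l.getD i 0 = l.getD j 0) : i = j := by
  rw [List.getD_eq_getElem _ _ hi, List.getD_eq_getElem _ _ hj] at hij
  exact (hl.getElem_inj_iff).1 hij

/-- Marked servers and the unmarked servers of the single blocks are pairwise disjoint, so a
collision would occur inside LR or inside one run of the subroutine. -/
theorem answer_inj {A : OnlineAlg} (hA : ∀ i, IsMatching (D.positions (D.unmarkedServers i))
      (A.output (D.positions (D.unmarkedServers i)) ((D.stayList x i D.n).map x)))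
    {a b : ℕ} (ha : a < D.n) (hb : b < D.n) (hab : D.answer x A a = D.answer x A b) : a = b := by
  by_cases hma : D.markAt x a = .unmarked <;> by_cases hmb : D.markAt x b = .unmarked
  · have h1 := answer_mem_unmarked hA ha hma
    have h2 := answer_mem_unmarked hA hb hmb
    rw [← hab] at h2
    have hB := h.block_eq_of_mem_unmarked h1 h2
    rw [answer_of_unmarked A hma, answer_of_unmarked A hmb, ← hB] at hab
    have hlt := subAnswer_lt hA hb hmb
    rw [← hB] at hlt
    have hsub := getD_inj (nodup_unmarkedServers _) (subAnswer_lt hA ha hma) hlt hab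
    have hp := hA (D.block (x a))
    rw [output_block, IsMatching] at hp
    have hnd : ((D.stayList x (D.block (x a)) D.n).map (D.subAnswer x A)).Nodup :=
      hp.nodup_iff.2 List.nodup_range
    exact List.inj_on_of_nodup_map hnd (mem_stayList.2 ⟨ha, hma, rfl⟩)
      (mem_stayList.2 ⟨hb, hmb, hB.symm⟩) hsub
  · exact absurd (hab ▸ h.answer_mem_marked A hb hmb)
      (notMem_marked_of_mem_unmarked (answer_mem_unmarked hA ha hma))
  · exact absurd (hab ▸ h.answer_mem_marked A ha hma)
      (notMem_marked_of_mem_unmarked (answer_mem_unmarked hA hb hmb))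
  · have ha' := mem_markedFrom.2 ⟨⟨Nat.zero_le _, ha⟩, hma⟩
    have hb' := mem_markedFrom.2 ⟨⟨Nat.zero_le _, hb⟩, hmb⟩
    rw [answer_of_marked A hma, answer_of_marked A hmb] at hab
    exact h.lr_le.2.1 ha' hb' (getD_inj nodup_markedServers (h.lr_le.1 a ha') (h.lr_le.1 b hb') hab)

theorem answer_lt {A : OnlineAlg} (hA : ∀ i, IsMatching (D.positions (D.unmarkedServers i))
      (A.output (D.positions (D.unmarkedServers i)) ((D.stayList x i D.n).map x)))
    {a : ℕ} (ha : a < D.n) : D.answer x A a < D.n := by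
  by_cases hm : D.markAt x a = .unmarked
  · exact (mem_unmarkedServers.1 (answer_mem_unmarked hA ha hm)).1
  · exact (mem_markedServers.1 (h.answer_mem_marked A ha hm)).1

/-- DIVIDE produces a perfect matching. -/
theorem map_answer_perm {A : OnlineAlg} (hA : ∀ i, IsMatching (D.positions (D.unmarkedServers i))
      (A.output (D.positions (D.unmarkedServers i)) ((D.stayList x i D.n).map x))) :
    ((List.range D.n).map (D.answer x A)).Perm (List.range D.n) := by
  have hnd : ((List.range D.n).map (D.answer x A)).Nodup :=
    List.nodup_range.map_on fun a ha b hb hab =>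
      h.answer_inj hA (by simpa using ha) (by simpa using hb) hab
  refine (hnd.subperm fun j hj => ?_).perm_of_length_le (by simp)
  obtain ⟨a, ha, rfl⟩ := List.mem_map.1 hj
  simpa using h.answer_lt hA (by simpa using ha)

open Classical in
theorem sum_eq_marked_add_blocks (g : ℕ → ℝ) :
    ∑ a ∈ Finset.range D.n, g a = ∑ a ∈ markedFrom (D.markAt x) D.n 0, g a +
      ∑ i ∈ Finset.Ico 1 (D.k + 1), ((D.stayList x i D.n).map g).sum := by
  rw [← Finset.sum_filter_add_sum_filter_not (Finset.range D.n)
    (fun a => D.markAt x a ≠ .unmarked)]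
  congr 1
  · refine Finset.sum_congr ?_ fun _ _ => rfl
    ext a
    simp [mem_markedFrom]
  · rw [← Finset.sum_fiberwise_of_maps_to (t := Finset.Ico 1 (D.k + 1))
      (g := fun a => D.block (x a))]
    · refine Finset.sum_congr rfl fun i _ => ?_
      unfold stayList
      rw [sum_filter_range_eq, Finset.filter_filter]
      simp only [not_not]
    · intro a _
      have h1 := one_le_block (D := D) (x a)
      have h2 := block_le h.toIsDivideInput (x a)
      exact Finset.mem_Ico.2 ⟨h1, by omega⟩

theorem sum_answer_le {A : OnlineAlg} (hA : ∀ i, IsMatching (D.positions (D.unmarkedServers i))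
      (A.output (D.positions (D.unmarkedServers i)) ((D.stayList x i D.n).map x))) :
    ∑ a ∈ Finset.range D.n, |x a - D.srv (D.answer x A a)| ≤
      ∑ a ∈ markedFrom (D.markAt x) D.n 0, |x a - D.srv (D.optServer x a)| +
      ∑ i ∈ Finset.Ico 1 (D.k + 1), matchingCost (D.positions (D.unmarkedServers i))
        ((D.stayList x i D.n).map x)
        (A.output (D.positions (D.unmarkedServers i)) ((D.stayList x i D.n).map x)) := by
  rw [h.sum_eq_marked_add_blocks]
  refine add_le_add (le_trans (le_of_eq ?_) h.lr_le.2.2) (le_of_eq ?_)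
  · refine Finset.sum_congr rfl fun a ha => ?_
    rw [answer_of_marked A (mem_markedFrom.1 ha).2]
  · refine Finset.sum_congr rfl fun i _ => ?_
    rw [output_block, matchingCost_map]
    refine congrArg List.sum (List.map_congr_left fun b hb => ?_)
    rw [mem_stayList] at hb
    have hlt := subAnswer_lt hA hb.1 hb.2.1
    rw [answer_of_unmarked A hb.2.1]
    rw [hb.2.2] at hlt ⊢
    rw [getD_positions _ hlt]

end IsAdvised

end DivideSetup


/-! ### Random matchings -/

section Random

variable {Ω : Type*} [MeasurableSpace Ω]

theorem IsRandomMatching.measurable_comp {s : List ℝ} {f : Ω → List ℕ} (hf : IsRandomMatching s f)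
    {β : Type*} [MeasurableSpace β] (g : List ℕ → β) : Measurable fun ω => g (f ω) := by
  -- Lists of numbers are countable, so measurability of the fibres gives measurability for the
  -- discrete σ-algebra.
  let _ : MeasurableSpace (List ℕ) := ⊤
  have : Measurable f := measurable_to_countable' fun m => hf.measurable m
  exact (measurable_from_top (f := g)).comp this

/-- There are only finitely many matchings, so the integrand is bounded. -/
theorem IsRandomMatching.integrable {s : List ℝ} {f : Ω → List ℕ} (hf : IsRandomMatching s f)
    (μ : Measure Ω) [IsFiniteMeasure μ] (g : List ℕ → ℝ) : Integrable (fun ω => g (f ω)) μ := by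
  have hfin : {m : List ℕ | IsMatching s m}.Finite := by
    refine (List.finite_toSet (List.range s.length).permutations).subset fun m hm => ?_
    exact List.mem_permutations.2 hm
  obtain ⟨C, hC⟩ := (hfin.image fun m => ‖g m‖).bddAbove
  refine Integrable.of_bound (hf.measurable_comp g).aestronglyMeasurable C ?_
  exact Filter.Eventually.of_forall fun ω => hC ⟨f ω, hf.isMatching ω, rfl⟩

theorem measurableSet_map_eq (g : ℕ → Ω → ℕ) (L : List ℕ) (hg : ∀ a ∈ L, Measurable (g a))
    (m : List ℕ) : MeasurableSet {ω | (L.map fun a => g a ω) = m} := by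
  induction L generalizing m with
  | nil => simp
  | cons a L ih =>
    cases m with
    | nil => simp
    | cons j m =>
      simp only [List.map_cons, List.cons.injEq]
      exact (hg a (by simp) (measurableSet_singleton j)).inter
        (ih (fun b hb => hg b (by simp [hb])) m)

theorem matchingCost_replicate {n : ℕ} {m : List ℕ} (hm : m.length = n) (N : ℕ) {t : ℝ}
    (ht : 0 ≤ t) : matchingCost (List.replicate N 0) (List.replicate n t) m = n * t := by
  unfold matchingCost
  have h0 : ∀ j, (List.replicate N (0 : ℝ)).getD j 0 = 0 := fun j => by
    by_cases hj : j < N <;> simp [hj]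
  simp only [h0, sub_zero]
  induction m generalizing n with
  | nil => subst hm; simp
  | cons j m ih =>
    subst hm
    rw [List.length_cons, List.replicate_succ, List.zipWith_cons_cons, List.sum_cons, ih rfl]
    simp only [abs_of_nonneg ht]
    push_cast
    ring

/-- The competitive ratio is at least `1`. -/
theorem one_le_of_isCompetitive (μ : Measure Ω) [IsProbabilityMeasure μ] {A : Ω → OnlineAlg}
    {c : ℕ → ℝ} (hA : IsCompetitive μ A c) {n : ℕ} (hn : 1 ≤ n) : 1 ≤ c n := by
  obtain ⟨a, ha⟩ := hA
  have key : ∀ t : ℝ, 0 ≤ t → n * t ≤ c n * (n * t) + a := by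
    intro t ht
    have hin : IsInput (List.replicate n 0) (List.replicate n t) :=
      ⟨by simp [List.pairwise_replicate], by simp⟩
    obtain ⟨h1, h2⟩ := ha _ _ hin
    have hcost : ∀ m, IsMatching (List.replicate n 0) m →
        matchingCost (List.replicate n 0) (List.replicate n t) m = n * t := fun m hm =>
      matchingCost_replicate (by simpa using List.Perm.length_eq hm) n ht
    have hopt : optCost (List.replicate n 0) (List.replicate n t) ≤ n * t :=
      (optCost_le _ (List.Perm.refl _ : IsMatching _ _)).trans (hcost _ (List.Perm.refl _)).le
    have hopt' : n * t ≤ optCost (List.replicate n 0) (List.replicate n t) :=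
      le_optCost fun m hm => (hcost m hm).ge
    have : ∀ ω, matchingCost (List.replicate n 0) (List.replicate n t)
        ((A ω).output (List.replicate n 0) (List.replicate n t)) = n * t := fun ω =>
      hcost _ (h1.isMatching ω)
    simp only [this, integral_const, probReal_univ, smul_eq_mul, one_mul, List.length_replicate] at h2
    rwa [le_antisymm hopt hopt'] at h2
  by_contra hc
  have hc : 0 < 1 - c n := by linarith [not_le.1 hc]
  have hn' : (1 : ℝ) ≤ n := by exact_mod_cast hn
  have h0 := key 0 le_rfl
  -- For this `t` the inequality becomes `n * (a + 1) ≤ a`, which is false since the case `t = 0`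
  -- gives `0 ≤ a`.
  have := key ((a + 1) / (1 - c n)) (by apply div_nonneg <;> linarith)
  have h2 : (1 - c n) * ((a + 1) / (1 - c n)) = a + 1 := by field_simp
  have h3 : n * ((1 - c n) * ((a + 1) / (1 - c n))) ≤ a := by linarith
  rw [h2] at h3
  nlinarith

/-! ### The expected cost of DIVIDE -/

namespace DivideSetup.IsAdvised

variable {D : DivideSetup} {x : ℕ → ℝ} (h : IsAdvised D x) {A : Ω → OnlineAlg}
  (hA : ∀ s r : List ℝ, IsInput s r → IsRandomMatching s (fun ω => (A ω).output s r))

include h hA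

/-- Answers to marked requests do not depend on the outcome. The answer to an unmarked one is an
entry of the subroutine's output on its block, which is a random matching. -/
theorem measurable_answer {a : ℕ} (ha : a < D.n) : Measurable fun ω => D.answer x (A ω) a := by
  by_cases hm : D.markAt x a = .unmarked
  · have hb := hA _ _ (h.isInput_block (D.block (x a)))
    have hmem : a ∈ D.stayList x (D.block (x a)) D.n := mem_stayList.2 ⟨ha, hm, rfl⟩
    have hlt := List.idxOf_lt_length_of_mem hmem
    have := hb.measurable_comp fun l => (D.unmarkedServers (D.block (x a))).getD
      (l.getD ((D.stayList x (D.block (x a)) D.n).idxOf a) 0) 0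
    convert this using 2 with ω
    rw [answer_of_unmarked _ hm, output_block]
    congr 1
    rw [List.getD_eq_getElem _ _ (by simpa using hlt), List.getElem_map, List.getElem_idxOf]
  · simp only [answer_of_marked _ hm]
    exact measurable_const

theorem isRandomMatching_answer {s : List ℝ} (hs : s.length = D.n) :
    IsRandomMatching s fun ω => (List.range D.n).map (D.answer x (A ω)) where
  isMatching ω := by
    rw [IsMatching, hs]
    exact h.map_answer_perm fun i => (hA _ _ (h.isInput_block i)).isMatching ω
  measurable m := measurableSet_map_eq (fun a ω => D.answer x (A ω) a) _
    (fun a ha => h.measurable_answer hA (by simpa using ha)) m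

omit hA in
/-- The expected cost of DIVIDE. -/
theorem integral_sum_answer_le (μ : Measure Ω) [IsProbabilityMeasure μ] {c : ℕ → ℝ}
    (hc : Monotone c) (hc1 : 1 ≤ c (D.n ⌈/⌉ D.k)) {d : ℝ}
    (hA : ∀ s r : List ℝ, IsInput s r → IsRandomMatching s (fun ω => (A ω).output s r) ∧
      ∫ ω, matchingCost s r ((A ω).output s r) ∂μ ≤ c s.length * optCost s r + d) :
    ∫ ω, ∑ a ∈ Finset.range D.n, |x a - D.srv (D.answer x (A ω) a)| ∂μ ≤
      c (D.n ⌈/⌉ D.k) * ∑ a ∈ Finset.range D.n, |x a - D.srv (D.optServer x a)| + D.k * d := by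
  have hA1 := fun s r hi => (hA s r hi).1
  have hInt : ∀ i ∈ Finset.Ico 1 (D.k + 1), Integrable (fun ω =>
      matchingCost (D.positions (D.unmarkedServers i)) ((D.stayList x i D.n).map x)
        ((A ω).output (D.positions (D.unmarkedServers i)) ((D.stayList x i D.n).map x))) μ :=
    fun i _ => (hA1 _ _ (h.isInput_block i)).integrable μ _
  have hR := h.isRandomMatching_answer hA1 (s := D.servers) rfl
  have hInt0 : Integrable (fun ω => ∑ a ∈ Finset.range D.n, |x a - D.srv (D.answer x (A ω) a)|) μ := by
    have := hR.integrable μ fun l => matchingCost D.servers ((List.range D.n).map x) l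
    simp only [matchingCost_map, sum_map_range_eq] at this
    exact this
  calc ∫ ω, ∑ a ∈ Finset.range D.n, |x a - D.srv (D.answer x (A ω) a)| ∂μ
      ≤ ∫ ω, (∑ a ∈ markedFrom (D.markAt x) D.n 0, |x a - D.srv (D.optServer x a)| +
        ∑ i ∈ Finset.Ico 1 (D.k + 1), matchingCost (D.positions (D.unmarkedServers i))
          ((D.stayList x i D.n).map x) ((A ω).output (D.positions (D.unmarkedServers i))
            ((D.stayList x i D.n).map x))) ∂μ := by
        refine integral_mono hInt0 ((integrable_const _).add (integrable_finsetSum _ hInt))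
          fun ω => ?_
        exact h.sum_answer_le fun i => (hA1 _ _ (h.isInput_block i)).isMatching ω
    _ = ∑ a ∈ markedFrom (D.markAt x) D.n 0, |x a - D.srv (D.optServer x a)| +
        ∑ i ∈ Finset.Ico 1 (D.k + 1), ∫ ω, matchingCost (D.positions (D.unmarkedServers i))
          ((D.stayList x i D.n).map x) ((A ω).output (D.positions (D.unmarkedServers i))
            ((D.stayList x i D.n).map x)) ∂μ := by
        rw [integral_add (integrable_const _) (integrable_finsetSum _ hInt),
          integral_finsetSum _ hInt]
        simp
    _ ≤ c (D.n ⌈/⌉ D.k) * ∑ a ∈ markedFrom (D.markAt x) D.n 0, |x a - D.srv (D.optServer x a)| +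
        ∑ i ∈ Finset.Ico 1 (D.k + 1), (c (D.n ⌈/⌉ D.k) *
          ((D.stayList x i D.n).map fun b => |x b - D.srv (D.optServer x b)|).sum + d) := by
        refine add_le_add ?_ (Finset.sum_le_sum fun i _ => ?_)
        -- LR has ratio 1 on the marked part, which is weakened to the common ratio of the blocks.
        · exact le_mul_of_one_le_left (Finset.sum_nonneg fun _ _ => abs_nonneg _) hc1
        · refine (hA _ _ (h.isInput_block i)).2.trans (add_le_add ?_ le_rfl)
          exact mul_le_mul (hc (h.length_unmarkedServers_le i)) (h.optCost_block_le i)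
            (optCost_nonneg _ _) (by linarith)
    _ = _ := by
        rw [h.sum_eq_marked_add_blocks, Finset.sum_add_distrib, mul_add, Finset.mul_sum (Finset.Ico 1 (D.k + 1))]
        simp
        ring

end DivideSetup.IsAdvised

end Random

/-! ### RESCALE -/

/-- All advice is read with the servers; serving the requests reads none. -/
theorem rescale_serve (A : OnlineAlg) (k : ℕ) (s : List ℝ) (r : ℕ → ℝ) (D : DivideSetup) (a m : ℕ) :
    (RESCALE A k).serve ⟨s, D.stateAt (fun b => rescaleRequest s (r b)) a⟩
        ((List.range' a m).map r) =
      pure ((List.range' a m).map (D.answer (fun b => rescaleRequest s (r b)) A)) := by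
  induction m generalizing a with
  | zero => rfl
  | succ m ih =>
    have hstep := D.divideStep_stateAt (fun b => rescaleRequest s (r b)) A a
    have ih := ih (a + 1)
    rw [List.range'_succ, List.map_cons, List.map_cons]
    change ((RESCALE A k).serve ⟨s, (divideStep A (D.stateAt (fun b => rescaleRequest s (r b)) a)
      (rescaleRequest s (r a))).2⟩ ((List.range' (a + 1) m).map r) >>= fun js =>
        pure ((divideStep A (D.stateAt (fun b => rescaleRequest s (r b)) a)
          (rescaleRequest s (r a))).1 :: js)) = _
    rw [hstep, ih]
    rfl

open AdviceProg in
theorem rescale_run (A : OnlineAlg) (k : ℕ) (s : List ℝ) (r : ℕ → ℝ) {D : DivideSetup}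
    {l : List Bool} (hl : Reads (divideRead k (rescaleN s) (s.map (rescaleServer s))) l D) (n : ℕ) :
    Reads ((RESCALE A k).init s >>= fun st => (RESCALE A k).serve st ((List.range n).map r)) l
      ((List.range n).map (D.answer (fun b => rescaleRequest s (r b)) A)) := by
  have h1 : Reads (divideInit k (rescaleN s) (s.map (rescaleServer s))) l
      (D.stateAt (fun b => rescaleRequest s (r b)) 0) := hl.map _
  have h2 : Reads ((RESCALE A k).init s) l
      (⟨s, D.stateAt (fun b => rescaleRequest s (r b)) 0⟩ : (RESCALE A k).State) :=
    h1.map fun st => (⟨s, st⟩ : (RESCALE A k).State)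
  have h3 := rescale_serve A k s r D 0 n
  rw [← List.range_eq_range'] at h3
  have := h2.bind (f := fun st => (RESCALE A k).serve st ((List.range n).map r)) (l' := [])
    (c := (List.range n).map (D.answer (fun b => rescaleRequest s (r b)) A))
    (by rw [h3]; exact reads_pure _)
  simpa using this

/-- Scaling multiplies distances exactly; only the rounding of the request moves a point, by at most
1. -/
theorem abs_rescale_le (s : List ℝ) (u v : ℝ) :
    |rescaleRequest s u - rescaleServer s v| ≤ (s.length : ℝ) ^ 3 * |u - v| + 1 ∧
      (s.length : ℝ) ^ 3 * |u - v| ≤ |rescaleRequest s u - rescaleServer s v| + 1 := by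
  unfold rescaleRequest rescaleServer
  have h1 := Int.floor_le ((s.length : ℝ) ^ 3 * (u - s.headD 0))
  have h2 := (Int.lt_floor_add_one ((s.length : ℝ) ^ 3 * (u - s.headD 0))).le
  have h3 : (s.length : ℝ) ^ 3 * |u - v| = |(s.length : ℝ) ^ 3 * (u - s.headD 0) -
      (s.length : ℝ) ^ 3 * (v - s.headD 0)| := by
    rw [← mul_sub, abs_mul, abs_of_nonneg (a := (s.length : ℝ) ^ 3) (by positivity)]
    congr 2
    ring
  rw [h3]
  generalize (⌊(s.length : ℝ) ^ 3 * (u - s.headD 0)⌋ : ℝ) = f at *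
  generalize (s.length : ℝ) ^ 3 * (u - s.headD 0) = y at *
  generalize (s.length : ℝ) ^ 3 * (v - s.headD 0) = z at *
  constructor
  · rw [abs_le]
    constructor <;> rcases abs_cases (y - z) with h | h <;> linarith
  · have : |y - z| - 1 ≤ |f + 1 - (z + 1)| := by
      rcases abs_cases (y - z) with h | h <;> rcases abs_cases (f + 1 - (z + 1)) with h' | h' <;>
        linarith
    linarith

theorem headD_le {s : List ℝ} (hs : s.Pairwise (· ≤ ·)) {v : ℝ} (hv : v ∈ s) : s.headD 0 ≤ v := by
  cases s with
  | nil => simp at hv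
  | cons u s =>
    rcases List.mem_cons.1 hv with rfl | hv
    · simp
    · simpa using (List.pairwise_cons.1 hs).1 v hv

theorem le_getLastD {s : List ℝ} (hs : s.Pairwise (· ≤ ·)) {v : ℝ} (hv : v ∈ s) :
    v ≤ s.getLastD 0 := by
  rcases List.eq_nil_or_concat' s with rfl | ⟨l, u, rfl⟩
  · simp at hv
  · rcases List.mem_append.1 hv with hv | hv
    · simpa using (List.pairwise_append.1 hs).2.2 v hv u (by simp)
    · simp at hv
      simp [hv]

theorem rescaleServer_mono (s : List ℝ) : Monotone (rescaleServer s) := by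
  intro u v huv
  unfold rescaleServer
  have : (s.length : ℝ) ^ 3 * (u - s.headD 0) ≤ (s.length : ℝ) ^ 3 * (v - s.headD 0) := by gcongr
  linarith

theorem serverSpan_rescale {s : List ℝ} (hs : s ≠ []) :
    serverSpan (s.map (rescaleServer s)) = (s.length : ℝ) ^ 3 * serverSpan s := by
  have h1 : (s.map (rescaleServer s)).getLastD 0 = rescaleServer s (s.getLastD 0) := by
    simp [List.getLastD_eq_getLast?, List.getLast?_map, List.getLast?_eq_getLast_of_ne_nil hs]
  have h2 : (s.map (rescaleServer s)).headD 0 = rescaleServer s (s.headD 0) := by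
    cases s with
    | nil => exact absurd rfl hs
    | cons u s => simp
  unfold serverSpan
  rw [h1, h2]
  unfold rescaleServer
  ring

theorem rescale_sorted {s : List ℝ} (hs : s.Pairwise (· ≤ ·)) :
    (s.map (rescaleServer s)).Pairwise (· ≤ ·) :=
  List.pairwise_map.2 (hs.imp fun huv => rescaleServer_mono s huv)

theorem one_le_rescale {s : List ℝ} (hs : s.Pairwise (· ≤ ·)) {v : ℝ}
    (hv : v ∈ s.map (rescaleServer s)) : 1 ≤ v := by
  obtain ⟨u, hu, rfl⟩ := List.mem_map.1 hv
  unfold rescaleServer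
  have : 0 ≤ (s.length : ℝ) ^ 3 * (u - s.headD 0) :=
    mul_nonneg (by positivity) (sub_nonneg.2 (headD_le hs hu))
  linarith

theorem rescale_le_N {s : List ℝ} (hs : s.Pairwise (· ≤ ·)) {v : ℝ}
    (hv : v ∈ s.map (rescaleServer s)) : v + 1 ≤ (rescaleN s : ℝ) := by
  have h1 := le_getLastD (rescale_sorted hs) hv
  have h2 : (s.map (rescaleServer s)).headD 0 = 1 := by
    cases s with
    | nil => simp at hv
    | cons u s => simp [rescaleServer]
  have h3 := Nat.le_ceil (serverSpan (s.map (rescaleServer s)))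
  unfold rescaleN
  push_cast
  unfold serverSpan at h3 ⊢
  rw [h2] at h3 ⊢
  linarith

/-! ### The number of advice bits -/

theorem size_le_log {N : ℕ} (hN : 1 ≤ N) : (Nat.size N : ℝ) ≤ Real.log N / Real.log 2 + 1 := by
  have hpos : 0 < Nat.size N := Nat.size_pos.2 hN
  have h1 : 2 ^ (Nat.size N - 1) ≤ N := Nat.lt_size.1 (by omega)
  have h2 : ((2 : ℝ) ^ (Nat.size N - 1)) ≤ N := by exact_mod_cast h1
  have h3 := Real.log_le_log (by positivity) h2
  rw [Real.log_pow] at h3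
  have h4 := (le_div_iff₀ (Real.log_pos one_lt_two)).2 h3
  have h5 : ((Nat.size N - 1 : ℕ) : ℝ) = Nat.size N - 1 := by
    push_cast [Nat.cast_sub (show 1 ≤ Nat.size N from hpos)]
    ring
  rw [h5] at h4
  linarith

theorem log_rescaleN_le {s : List ℝ} (hs : s.Pairwise (· ≤ ·)) (hn : 2 ≤ s.length) :
    Real.log (rescaleN s) ≤ 4 * Real.log s.length + Real.posLog (serverSpan s) := by
  have hne : s ≠ [] := by rintro rfl; simp at hn
  have hn' : (2 : ℝ) ≤ s.length := by exact_mod_cast hn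
  set n : ℝ := (s.length : ℝ)
  have hspan : 0 ≤ serverSpan s := sub_nonneg.2 (by
    obtain ⟨v, hv⟩ := List.exists_mem_of_ne_nil s hne
    exact (headD_le hs hv).trans (le_getLastD hs hv))
  set M : ℝ := max 1 (serverSpan s)
  have hM1 : 1 ≤ M := le_max_left _ _
  have hM2 : serverSpan s ≤ M := le_max_right _ _
  have hlogM : Real.log M = Real.posLog (serverSpan s) := by
    rw [Real.posLog_eq_log_max_one hspan]
  have h8 : (8 : ℝ) ≤ n ^ 3 := by nlinarith [pow_le_pow_left₀ (by norm_num) hn' 3]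
  -- With `n ≥ 2` and `M ≥ 1`: N ≤ n³M + 3 ≤ 2n³M ≤ n⁴M.
  have hN : (rescaleN s : ℝ) ≤ n ^ 4 * M := by
    unfold rescaleN
    rw [serverSpan_rescale hne]
    have hc := (Nat.ceil_lt_add_one (a := n ^ 3 * serverSpan s) (by positivity)).le
    push_cast
    have h1 : n ^ 3 * serverSpan s ≤ n ^ 3 * M := by gcongr
    have h2 : 8 * 1 ≤ n ^ 3 * M := mul_le_mul h8 hM1 (by norm_num) (by positivity)
    have h3 : 2 * (n ^ 3 * M) ≤ n * (n ^ 3 * M) := by gcongr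
    calc _ ≤ 2 * (n ^ 3 * M) := by linarith
      _ ≤ _ := h3
      _ = _ := by ring
  have hpos : (0 : ℝ) < rescaleN s := by
    unfold rescaleN
    positivity
  calc Real.log (rescaleN s) ≤ Real.log (n ^ 4 * M) := Real.log_le_log hpos hN
    _ = _ := by
      rw [Real.log_mul (by positivity) (by positivity), Real.log_pow, hlogM]
      norm_num

theorem bits_le {s : List ℝ} (hs : s.Pairwise (· ≤ ·)) {k b : ℕ} (hk1 : 1 ≤ k) (hk : k ≤ s.length)
    (hb : b ≤ (k - 1) * (2 * Nat.size (rescaleN s) + 4 * Nat.size s.length)) :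
    (b : ℝ) ≤ 18 / Real.log 2 * (k * (Real.posLog (serverSpan s) + Real.log s.length)) := by
  have hl2 := Real.log_pos one_lt_two
  have hp := Real.posLog_nonneg (x := serverSpan s)
  rcases hk1.eq_or_lt with rfl | hk2
  -- One block needs no advice. This case is separate because the bound may be 0 for `n = 1`; from
  -- `k ≥ 2` on, `log 2 ≤ log n`.
  · simp only [Nat.sub_self, zero_mul, nonpos_iff_eq_zero] at hb
    rw [hb]
    have := Real.log_natCast_nonneg s.length
    push_cast
    positivity
  · have hn : 2 ≤ s.length := by omega
    have hn' : (2 : ℝ) ≤ s.length := by exact_mod_cast hn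
    have h1 := size_le_log (N := rescaleN s) (by unfold rescaleN; omega)
    have h2 := size_le_log (N := s.length) (by omega)
    have h3 := log_rescaleN_le hs hn
    have h4 : Real.log 2 ≤ Real.log s.length := Real.log_le_log (by norm_num) hn'
    have hb' : (b : ℝ) ≤ k * (2 * Nat.size (rescaleN s) + 4 * Nat.size s.length) := by
      have : b ≤ k * (2 * Nat.size (rescaleN s) + 4 * Nat.size s.length) :=
        hb.trans (Nat.mul_le_mul_right _ (by omega))
      exact_mod_cast this
    refine hb'.trans ?_
    -- Times log 2, the left side is at most 2(4 log n + log⁺) + 4 log n + 6 log 2, and log 2 ≤ log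
    -- n gives the factor 18.
    have h5 : 2 * (Nat.size (rescaleN s) : ℝ) + 4 * Nat.size s.length ≤
        18 / Real.log 2 * (Real.posLog (serverSpan s) + Real.log s.length) := by
      have h6 : 18 / Real.log 2 * (Real.posLog (serverSpan s) + Real.log s.length) =
        18 * (Real.posLog (serverSpan s) + Real.log s.length) / Real.log 2 := by ring
      rw [h6, le_div_iff₀ hl2]
      have e1 : (Real.log (rescaleN s) / Real.log 2 + 1) * Real.log 2 =
        Real.log (rescaleN s) + Real.log 2 := by field_simp
      have e2 : (Real.log s.length / Real.log 2 + 1) * Real.log 2 =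
        Real.log s.length + Real.log 2 := by field_simp
      have h7 := mul_le_mul_of_nonneg_right h1 hl2.le
      have h8 := mul_le_mul_of_nonneg_right h2 hl2.le
      rw [e1] at h7
      rw [e2] at h8
      linarith
    calc _ ≤ (k : ℝ) * (18 / Real.log 2 * (Real.posLog (serverSpan s) + Real.log s.length)) := by
          gcongr
      _ = _ := by ring

/-! ### The main theorem -/

/-- The monotone matching of the rescaled input costs at most `n³` times the optimum, plus `n`. -/
theorem sum_optServer_le_optCost {s r : List ℝ} (hin : IsInput s r) {D : DivideSetup}
    (hD : D.servers = s.map (rescaleServer s))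
    (h : IsDivideInput D fun a => rescaleRequest s (r.getD a 0)) :
    ∑ a ∈ Finset.range s.length, |rescaleRequest s (r.getD a 0) -
        D.srv (D.optServer (fun a => rescaleRequest s (r.getD a 0)) a)| ≤
      (s.length : ℝ) ^ 3 * optCost s r + s.length := by
  have hn : D.n = s.length := by simp [DivideSetup.n, hD]
  have hpos : (0 : ℝ) < (s.length : ℝ) ^ 3 := by
    have : 0 < s.length := hn ▸ h.one_le_k.trans h.k_le
    positivity
  rw [← sub_le_iff_le_add, ← div_le_iff₀' hpos]
  refine le_optCost fun m hm => ?_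
  rw [div_le_iff₀' hpos, sub_le_iff_le_add]
  have hlen : m.length = s.length := by simpa using List.Perm.length_eq hm
  have hmr : ∀ {l : List ℝ}, l.length = s.length → l = (List.range s.length).map fun a => l.getD a 0 :=
    fun {l} hl => List.ext_getElem (by simp [hl]) fun i h1 h2 => by simp [h1]
  have hmm : m = (List.range s.length).map fun a => m.getD a 0 :=
    List.ext_getElem (by simp [hlen]) fun i h1 h2 => by simp [h1]
  have hnd : m.Nodup := (List.Perm.nodup_iff hm).2 List.nodup_range
  have hlt : ∀ a < s.length, m.getD a 0 < s.length := fun a ha => by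
    rw [List.getD_eq_getElem _ _ (hlen ▸ ha)]
    simpa using List.Perm.subset hm (List.getElem_mem (hlen ▸ ha : a < m.length))
  have key := DivideSetup.sum_optServer_le h (fun a => m.getD a 0)
    (fun a ha => by
      rw [hn] at ha ⊢
      simpa using hlt a (by simpa using ha))
    (fun a ha b hb hab => by
      rw [hn] at ha hb
      exact DivideSetup.IsAdvised.getD_inj hnd (by simpa [hlen] using ha) (by simpa [hlen] using hb)
        hab)
  rw [hn] at key
  refine key.trans ?_
  have hcost : matchingCost s r m = ∑ a ∈ Finset.range s.length, |r.getD a 0 - s.getD (m.getD a 0) 0| := by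
    conv_lhs => rw [hmr hin.length_eq, hmm]
    rw [matchingCost_map, sum_map_range_eq]
  rw [hcost, Finset.mul_sum]
  calc _ ≤ ∑ a ∈ Finset.range s.length,
        ((s.length : ℝ) ^ 3 * |r.getD a 0 - s.getD (m.getD a 0) 0| + 1) := by
        refine Finset.sum_le_sum fun a ha => ?_
        have := hlt a (by simpa using ha)
        have hsrv : D.srv (m.getD a 0) = rescaleServer s (s.getD (m.getD a 0) 0) := by
          unfold DivideSetup.srv
          rw [hD, List.getD_eq_getElem _ _ (by simpa using this), List.getD_eq_getElem _ _ this,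
            List.getElem_map]
        rw [hsrv]
        exact (abs_rescale_le s _ _).1
    _ = _ := by
      rw [Finset.sum_add_distrib]
      simp

/-- A nondecreasing function that is `o(n²)` is bounded by a multiple of `n²`. -/
theorem exists_le_sq {c : ℕ → ℝ} (hc : Monotone c)
    (ho : c =o[Filter.atTop] (fun m : ℕ => (m : ℝ) ^ 2)) :
    ∃ K : ℝ, ∀ n : ℕ, 1 ≤ n → c n ≤ K * (n : ℝ) ^ 2 := by
  obtain ⟨m, hm⟩ := Filter.eventually_atTop.1 (ho.bound one_pos)
  refine ⟨|c m| + 1, fun n hn => ?_⟩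
  have hn' : (1 : ℝ) ≤ (n : ℝ) ^ 2 := one_le_pow₀ (by exact_mod_cast hn)
  rcases le_total m n with hmn | hmn
  · have h1 := hm n hmn
    rw [Real.norm_eq_abs, Real.norm_eq_abs, abs_of_nonneg (a := (n : ℝ) ^ 2) (by positivity)] at h1
    have h2 := le_abs_self (c n)
    nlinarith [abs_nonneg (c m)]
  · have h1 := hc hmn
    have h2 := le_abs_self (c m)
    nlinarith [abs_nonneg (c m)]

end

theorem mainTheorem4 :
    ∃ C : ℝ, ∀ {Ω : Type*} [MeasurableSpace Ω] (μ : MeasureTheory.Measure Ω)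
      [MeasureTheory.IsProbabilityMeasure μ] (A : Ω → OnlineAlg) (c : ℕ → ℝ),
      Monotone c →
      c =o[Filter.atTop] (fun m : ℕ => (m : ℝ) ^ 2) →
      IsCompetitive μ A c →
      ∃ b : ℝ, ∀ (k : ℕ) (s r : List ℝ), IsInput s r → 1 ≤ k → k ≤ s.length →
        ∃ φ : ℕ → Bool,
          IsRandomMatching s (fun ω => (RESCALE (A ω) k).output s r φ) ∧
          ∫ ω, matchingCost s r ((RESCALE (A ω) k).output s r φ) ∂μ
            ≤ c (s.length ⌈/⌉ k) * optCost s r + b ∧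
          ∀ ω, ((RESCALE (A ω) k).bitsRead s r φ : ℝ)
            ≤ C * (k * (Real.posLog (serverSpan s) + Real.log s.length)) := by
  refine ⟨18 / Real.log 2, ?_⟩
  intro Ω _ μ _ A c hc ho hA
  obtain ⟨K, hK⟩ := exists_le_sq hc ho
  have hone : ∀ n, 1 ≤ n → 1 ≤ c n := fun n hn => one_le_of_isCompetitive μ hA hn
  obtain ⟨d, hd⟩ := hA
  -- On the enlarged scale `K` pays for rounding in the optimum, multiplied by the ratio (`c * n ≤ K
  -- * n³`), `|d|` for the additive constants of the blocks, and 1 for rounding in the cost of the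
  -- algorithm.
  refine ⟨K + |d| + 1, ?_⟩
  intro k s r hin hk1 hkn
  have hA1 := fun s r hi => (hd s r hi).1
  set x : ℕ → ℝ := fun a => rescaleRequest s (r.getD a 0) with hx
  obtain ⟨D, l, hDs, hDk, -, hadv, hlen, hreads⟩ := DivideSetup.exists_isAdvised
    (s.map (rescaleServer s)) k (rescaleN s) x (rescale_sorted hin.sorted)
    (fun v hv => one_le_rescale hin.sorted hv) (fun v hv => rescale_le_N hin.sorted hv)
    (fun a => ⟨⌊(s.length : ℝ) ^ 3 * (r.getD a 0 - s.headD 0)⌋ + 1, by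
      simp [hx, rescaleRequest]⟩) hk1 (by simpa using hkn)
  have hDn : D.n = s.length := by simp [DivideSetup.n, hDs]
  have hr : r = (List.range s.length).map fun a => r.getD a 0 :=
    List.ext_getElem (by simp [hin.length_eq]) fun i h1 h2 => by simp [h1]
  have hrun : ∀ ω, ((RESCALE (A ω) k).init s >>= fun st => (RESCALE (A ω) k).serve st r).run
      (l.foldr AdviceProg.consTape fun _ => false) =
      ((List.range D.n).map (D.answer x (A ω)), l.length) := fun ω => by
    have := rescale_run (A ω) k s (fun a => r.getD a 0) hreads s.length fun _ => false
    rw [← hr] at this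
    rw [hDn]
    exact this
  have hout : ∀ ω, (RESCALE (A ω) k).output s r (l.foldr AdviceProg.consTape fun _ => false) =
      (List.range D.n).map (D.answer x (A ω)) := fun ω => congrArg Prod.fst (hrun ω)
  have hbits : ∀ ω, (RESCALE (A ω) k).bitsRead s r (l.foldr AdviceProg.consTape fun _ => false) =
      l.length := fun ω => congrArg Prod.snd (hrun ω)
  -- The advice word followed by zeros; it does not depend on the random outcome.
  refine ⟨l.foldr AdviceProg.consTape fun _ => false, ?_, ?_, ?_⟩
  · simp only [hout]
    exact hadv.isRandomMatching_answer hA1 hDn.symm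
  · simp only [hout]
    have hR := hadv.isRandomMatching_answer hA1 (s := s) hDn.symm
    set n := s.length with hn
    have hn1 : 1 ≤ n := hk1.trans hkn
    have hn1' : (1 : ℝ) ≤ n := by exact_mod_cast hn1
    have hq1 : 1 ≤ n ⌈/⌉ k := by
      rw [ceilDiv_eq_div_or hk1]
      have := Nat.div_pos hkn hk1
      omega
    have hqn : n ⌈/⌉ k ≤ n := by
      rw [ceilDiv_le_iff_le_mul hk1]
      exact Nat.le_mul_of_pos_left n hk1
    have hcost : ∀ ω, (n : ℝ) ^ 3 * matchingCost s r ((List.range D.n).map (D.answer x (A ω))) ≤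
        ∑ a ∈ Finset.range D.n, |x a - D.srv (D.answer x (A ω) a)| + n := fun ω => by
      have hlt : ∀ a < D.n, D.answer x (A ω) a < s.length := fun a ha =>
        (hadv.answer_lt (fun i => (hA1 _ _ (hadv.isInput_block i)).isMatching ω) ha).trans_eq hDn
      rw [hDn] at hlt ⊢
      conv_lhs => rw [hr]
      rw [matchingCost_map, sum_map_range_eq, Finset.mul_sum]
      calc _ ≤ ∑ a ∈ Finset.range n, (|x a - D.srv (D.answer x (A ω) a)| + 1) := by
            refine Finset.sum_le_sum fun a ha => ?_
            have := hlt a (by simpa using ha)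
            have hsrv : D.srv (D.answer x (A ω) a) =
                rescaleServer s (s.getD (D.answer x (A ω) a) 0) := by
              unfold DivideSetup.srv
              rw [hDs, List.getD_eq_getElem _ _ (by simpa using this),
                List.getD_eq_getElem _ _ this, List.getElem_map]
            rw [hsrv]
            exact (abs_rescale_le s _ _).2
        _ = _ := by
          rw [Finset.sum_add_distrib]
          simp
    have hInt0 : Integrable (fun ω => ∑ a ∈ Finset.range D.n,
        |x a - D.srv (D.answer x (A ω) a)|) μ := by
      have := (hadv.isRandomMatching_answer hA1 (s := D.servers) rfl).integrable μ
        fun l => matchingCost D.servers ((List.range D.n).map x) l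
      simp only [matchingCost_map, sum_map_range_eq] at this
      exact this
    have hE : (n : ℝ) ^ 3 * ∫ ω, matchingCost s r ((List.range D.n).map (D.answer x (A ω))) ∂μ ≤
        ∫ ω, ∑ a ∈ Finset.range D.n, |x a - D.srv (D.answer x (A ω) a)| ∂μ + n := by
      rw [← integral_const_mul]
      refine (integral_mono ((hR.integrable μ _).const_mul _)
        (hInt0.add (integrable_const (n : ℝ))) hcost).trans (le_of_eq ?_)
      simp only [Pi.add_apply]
      rw [integral_add hInt0 (integrable_const _)]
      simp
    have hdiv := hadv.integral_sum_answer_le μ hc (hone _ (by rw [hDn, hDk]; exact hq1)) hd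
    have hopt := sum_optServer_le_optCost hin hDs hadv.toIsDivideInput
    rw [hDn, hDk] at hdiv
    rw [hDn] at hE
    have hcc := hone _ hq1
    have hcK := (hc hqn).trans (hK n hn1)
    have hkn' : (k : ℝ) ≤ n := by exact_mod_cast hkn
    have h1 : c (n ⌈/⌉ k) * ∑ a ∈ Finset.range n, |x a - D.srv (D.optServer x a)| ≤
        c (n ⌈/⌉ k) * ((n : ℝ) ^ 3 * optCost s r + n) :=
      mul_le_mul_of_nonneg_left hopt (by linarith)
    have h2 : (k : ℝ) * d ≤ n * |d| :=
      (mul_le_mul_of_nonneg_left (le_abs_self d) (by positivity)).trans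
        (mul_le_mul_of_nonneg_right hkn' (abs_nonneg d))
    have h3 : (n : ℝ) ≤ (n : ℝ) ^ 3 := le_self_pow₀ hn1' (by norm_num)
    have h4 : (n : ℝ) * |d| ≤ (n : ℝ) ^ 3 * |d| := mul_le_mul_of_nonneg_right h3 (abs_nonneg d)
    have h5 : c (n ⌈/⌉ k) * n ≤ K * (n : ℝ) ^ 2 * n := mul_le_mul_of_nonneg_right hcK (by positivity)
    refine le_of_mul_le_mul_left ?_ (show (0 : ℝ) < (n : ℝ) ^ 3 by positivity)
    rw [hDn]
    linarith
  · intro ω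
    rw [hbits ω]
    exact bits_le hin.sorted hk1 hkn (by simpa using hlen)
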